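/- Let $\mathbb{R}_+=(0,\infty)$, $U=L^2(\mathbb{R})$, $\mathcal{L}^2=L^2(\mathbb{R}_+)\oplus L^2(\mathbb{R}_+)\oplus\mathbb{R}$, let $\eta_+,\eta_-,c>0$, and let $\Delta$ be the Dirichlet Laplacian on $L^2(\mathbb{R}_+)$, i.e. $\Delta f=f''$ (second weak derivative) with domain $D=H^2(\mathbb{R}_+)\cap H^1_0(\mathbb{R}_+)$. Let $\mathcal{A}=\mathrm{diag}(\eta_+\Delta,\eta_-\Delta,0)-c\,\mathrm{id}$ on $\mathcal{L}^2$, whose domain $D(\mathcal{A})=D\times D\times\mathbb{R}$ is equipped with the Hilbert graph norm $\|u\|_{\mathcal{A}}=(\|u\|_{\mathcal{L}^2}^2+\|\mathcal{A}u\|_{\mathcal{L}^2}^2)^{1/2}$ (equivalent to the $H^2\oplus H^2\oplus\mathbb{R}$ norm). Assume that $\sigma_\pm:\mathbb{R}^2\to\mathbb{R}$ are twice continuously differentiable and that each $\sigma\in\{\sigma_+,\sigma_-\}$ satisfies: (i) for all integers $i,j\ge 0$ with $i+j\le 2$ there are $a\in L^2(\mathbb{R}_+)$ and $b\in L^\infty_{loc}(\mathbb{R};[0,\infty))$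 such that for all $x,y\in\mathbb{R}$, $|\partial_x^i\partial_y^j\sigma(x,y)|\le a(|x|)+b(y)|y|$ if $j=0$, and $|\partial_x^i\partial_y^j\sigma(x,y)|\le b(y)$ if $j\neq 0$; (ii) for all $i,j\ge0$ with $i+j\le 2$ and every $r$ there is $L_r$ such that $|\partial_x^i\partial_y^j\sigma(x,y)-\partial_x^i\partial_y^j\sigma(x,z)|\le L_r|y-z|$ for all $x\in\mathbb{R}$ and $|y|,|z|\le r$; (iii) $\sigma(0,0)=0$. Assume that $\zeta:\mathbb{R}^2\to\mathbb{R}$ satisfies $\zeta(\cdot,y)\in C^3(\mathbb{R})$ for all $y$, $\partial_x^i\zeta(x,\cdot)\in L^2(\mathbb{R})$ for all $x$, and $\sup_{x\in\mathbb{R}}\|\partial_x^i\zeta(x,\cdot)\|_{L^2(\mathbb{R})}<\infty$, for $i=0,1,2,3$. Put $T_\zeta w(x)=\int_{\mathbb{R}}\zeta(x,y)w(y)\,dy$ for $w\in U$. Then for every $u=(u_1,u_2,u_3)\in D(\mathcal{A})$ the formula $$(\mathcal{C}(u)w)(x)=\begin{pmatrix}\sigma_+(x,u_1(x))\,(T_\zeta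 w)(u_3+x)\\ \sigma_-(-x,u_2(x))\,(T_\zeta w)(u_3-x)\\ 0\end{pmatrix},\qquad w\in U,\ x>0,$$ defines a Hilbert–Schmidt operator $\mathcal{C}(u)\in HS(U,D(\mathcal{A}))$, and the map $\mathcal{C}:D(\mathcal{A})\to HS(U,D(\mathcal{A}))$ is Lipschitz continuous on bounded sets: for every bounded $B\subset D(\mathcal{A})$ there is $L$ such that $\|\mathcal{C}(u)-\mathcal{C}(v)\|_{HS(U,D(\mathcal{A}))}\le L\|u-v\|_{\mathcal{A}}$ for all $u,v\in B$. -/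

import Mathlib

open MeasureTheory Set
open scoped ENNReal NNReal ContDiff

noncomputable section

/-! ### Hilbert-Schmidt operators -/

section HilbertSchmidt

variable (U : Type*) [NormedAddCommGroup U] [InnerProductSpace ℝ U] [CompleteSpace U]
variable (E : Type*) [NormedAddCommGroup E] [InnerProductSpace ℝ E]

/-- Index set of a complete orthonormal system of the Hilbert space `U`. -/
def onbIndex : Set U := (exists_hilbertBasis ℝ U).choose

/-- A complete orthonormal system of `U`; the Hilbert-Schmidt norm does not depend on it,
see `HS.norm_sq_eq`. -/
def onb : HilbertBasis (onbIndex U) ℝ U := (exists_hilbertBasis ℝ U).choose_spec.choose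

/-! `∑ ‖T eᵢ‖²` is the same for all complete orthonormal systems. -/

theorem tsum_enorm_sq_hilbertBasis {ι U : Type*} [NormedAddCommGroup U] [InnerProductSpace ℝ U]
    (b : HilbertBasis ι ℝ U) (u : U) : ∑' i, ‖inner ℝ u (b i)‖ₑ ^ 2 = ‖u‖ₑ ^ 2 := by
  have h := b.hasSum_inner_mul_inner u u
  have h' : HasSum (fun i => ‖inner ℝ u (b i)‖ ^ 2) (‖u‖ ^ 2) := by
    rw [← real_inner_self_eq_norm_sq]
    have e : ∀ i, ‖inner ℝ u (b i)‖ ^ 2 = inner ℝ u (b i) * inner ℝ (b i) u := fun i => by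
      rw [Real.norm_eq_abs, sq_abs, real_inner_comm u (b i), sq]
    simp_rw [e]
    exact h
  have e : ∀ i, ‖inner ℝ u (b i)‖ₑ ^ 2 = ENNReal.ofReal (‖inner ℝ u (b i)‖ ^ 2) := fun i => by
    rw [ENNReal.ofReal_pow (norm_nonneg _), ofReal_norm]
  simp_rw [e]
  rw [← ENNReal.ofReal_tsum_of_nonneg (fun _ => by positivity) h'.summable, h'.tsum_eq,
    ENNReal.ofReal_pow (norm_nonneg _), ofReal_norm]

theorem tsum_hilbertBasis_eq_adjoint {ι U E : Type*}
    [NormedAddCommGroup U] [InnerProductSpace ℝ U] [CompleteSpace U]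
    [NormedAddCommGroup E] [InnerProductSpace ℝ E] [CompleteSpace E] (b : HilbertBasis ι ℝ U)
    (S : U →L[ℝ] E) :
    ∑' i, ‖S (b i)‖ₑ ^ 2 = ∑' j, ‖S.adjoint (onb E j)‖ₑ ^ 2 := by
  calc ∑' i, ‖S (b i)‖ₑ ^ 2 = ∑' i, ∑' j, ‖inner ℝ (S (b i)) (onb E j)‖ₑ ^ 2 := by
        simp_rw [tsum_enorm_sq_hilbertBasis (onb E)]
    _ = ∑' j, ∑' i, ‖inner ℝ (S (b i)) (onb E j)‖ₑ ^ 2 := ENNReal.tsum_comm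
    _ = ∑' j, ∑' i, ‖inner ℝ (S.adjoint (onb E j)) (b i)‖ₑ ^ 2 := by
        simp_rw [ContinuousLinearMap.adjoint_inner_left, real_inner_comm]
    _ = _ := by simp_rw [tsum_enorm_sq_hilbertBasis b]

theorem tsum_hilbertBasis_eq {ι κ U E : Type*}
    [NormedAddCommGroup U] [InnerProductSpace ℝ U] [CompleteSpace U]
    [NormedAddCommGroup E] [InnerProductSpace ℝ E] (b : HilbertBasis ι ℝ U)
    (c : HilbertBasis κ ℝ U) (T : U →L[ℝ] E) :
    ∑' i, ‖T (b i)‖ₑ ^ 2 = ∑' k, ‖T (c k)‖ₑ ^ 2 := by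
  let J : E →L[ℝ] UniformSpace.Completion E := UniformSpace.Completion.toComplL
  have hS : ∀ u, ‖T u‖ₑ = ‖(J.comp T) u‖ₑ := fun u =>
    (enorm_eq_iff_norm_eq.mpr (UniformSpace.Completion.norm_coe (T u))).symm
  simp_rw [hS]
  rw [tsum_hilbertBasis_eq_adjoint b, tsum_hilbertBasis_eq_adjoint c]

/-- The bounded operators `T : U → E` with `∑ ‖T eᵢ‖² < ∞`. -/
def hsSubmodule : Submodule ℝ (U →L[ℝ] E) where
  carrier := {T | Memℓp (fun i => T (onb U i)) 2}
  zero_mem' := by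
    exact (zero_memℓp : Memℓp (0 : onbIndex U → E) 2)
  add_mem' := by
    intro S T hS hT
    exact hS.add hT
  smul_mem' := by
    intro c T hT
    exact hT.const_smul c

/-- The space `HS(U, E)` of Hilbert-Schmidt operators (a type synonym, since it carries the
Hilbert-Schmidt norm and not the operator norm). -/
def HS : Type _ := hsSubmodule U E

namespace HS

instance : AddCommGroup (HS U E) := inferInstanceAs (AddCommGroup (hsSubmodule U E))
instance : Module ℝ (HS U E) := inferInstanceAs (Module ℝ (hsSubmodule U E))

variable {U E}

/-- The underlying bounded operator. -/
def toCLM (T : HS U E) : U →L[ℝ] E := Subtype.val (p := fun T => T ∈ hsSubmodule U E) T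

variable (U E)

/-- The map `T ↦ (T eᵢ)ᵢ ∈ ℓ²`. -/
def toLp : HS U E →ₗ[ℝ] lp (fun _ : onbIndex U => E) 2 where
  toFun T := ⟨fun i => T.toCLM (onb U i), Subtype.prop (p := fun T => T ∈ hsSubmodule U E) T⟩
  map_add' _ _ := rfl
  map_smul' _ _ := rfl

theorem toLp_injective : Function.Injective (toLp U E) := by
  intro S T h
  have h1 : ∀ i, S.toCLM (onb U i) = T.toCLM (onb U i) := fun i =>
    congrFun (congrArg Subtype.val h) i
  have h2 : S.toCLM = T.toCLM := by
    refine ContinuousLinearMap.ext_on (s := Set.range (onb U)) ?_ ?_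
    · have := (onb U).dense_span
      rw [Submodule.dense_iff_topologicalClosure_eq_top]
      exact this
    · rintro _ ⟨i, rfl⟩
      exact h1 i
  exact Subtype.ext h2

/-- The Hilbert-Schmidt norm `‖T‖ = (∑ ‖T eᵢ‖²)^(1/2)`. -/
instance : NormedAddCommGroup (HS U E) :=
  NormedAddCommGroup.induced (HS U E) (lp (fun _ : onbIndex U => E) 2) (toLp U E)
    (toLp_injective U E)

instance : NormedSpace ℝ (HS U E) :=
  NormedSpace.induced ℝ (HS U E) (lp (fun _ : onbIndex U => E) 2) (toLp U E)

variable {U E}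

/-- The norm of `HS U E` is computed by every complete orthonormal system of `U`. -/
theorem norm_sq_eq {ι : Type*} (b : HilbertBasis ι ℝ U) (T : HS U E) :
    ENNReal.ofReal (‖T‖ ^ 2) = ∑' i, ‖T.toCLM (b i)‖ₑ ^ 2 := by
  rw [tsum_hilbertBasis_eq b (onb U)]
  have h := lp.hasSum_norm (p := 2) (by norm_num) (toLp U E T)
  have h' : HasSum (fun i => ‖T.toCLM (onb U i)‖ ^ 2) (‖T‖ ^ 2) := by
    have e : ‖T‖ = ‖toLp U E T‖ := rfl
    have e2 : (2 : ℝ≥0∞).toReal = ((2 : ℕ) : ℝ) := by norm_num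
    rw [e]
    simp_rw [e2, Real.rpow_natCast] at h
    exact h
  have e : ∀ i, ‖T.toCLM (onb U i)‖ₑ ^ 2 = ENNReal.ofReal (‖T.toCLM (onb U i)‖ ^ 2) := fun i => by
    rw [ENNReal.ofReal_pow (norm_nonneg _), ofReal_norm]
  simp_rw [e]
  rw [← ENNReal.ofReal_tsum_of_nonneg (fun _ => by positivity) h'.summable, h'.tsum_eq]

end HS

end HilbertSchmidt

/-! ### Domains of operators with the graph norm -/

/-- The domain of the (unbounded) operator `A`, equipped with the graph inner product
`⟪u, v⟫ + ⟪A u, A v⟫` and hence the graph norm (a type synonym of `A.domain`, which carries the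
norm of the ambient space). -/
def GraphDomain {E : Type*} [NormedAddCommGroup E] [InnerProductSpace ℝ E] (A : E →ₗ.[ℝ] E) :
    Type _ := A.domain

namespace GraphDomain

variable {E : Type*} [NormedAddCommGroup E] [InnerProductSpace ℝ E] (A : E →ₗ.[ℝ] E)

instance : AddCommGroup (GraphDomain A) := inferInstanceAs (AddCommGroup A.domain)
instance : Module ℝ (GraphDomain A) := inferInstanceAs (Module ℝ A.domain)

/-- The inclusion of the domain into the ambient space. -/
def incl : GraphDomain A →ₗ[ℝ] E := A.domain.subtype

/-- The operator `A` on its domain. -/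
def op : GraphDomain A →ₗ[ℝ] E := A.toFun

/-- The map `u ↦ (u, A u)`. -/
def toGraph : GraphDomain A →ₗ[ℝ] WithLp 2 (E × E) :=
  (WithLp.linearEquiv 2 ℝ (E × E)).symm.toLinearMap ∘ₗ (incl A).prod (op A)

theorem toGraph_injective : Function.Injective (toGraph A) := by
  intro u v h
  have h1 : incl A u = incl A v := congrArg WithLp.fst h
  exact Subtype.ext h1

instance : NormedAddCommGroup (GraphDomain A) :=
  NormedAddCommGroup.induced (GraphDomain A) (WithLp 2 (E × E)) (toGraph A) (toGraph_injective A)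

instance : InnerProductSpace ℝ (GraphDomain A) where
  toNormedSpace := NormedSpace.induced ℝ (GraphDomain A) (WithLp 2 (E × E)) (toGraph A)
  inner u v := inner ℝ (toGraph A u) (toGraph A v)
  norm_sq_eq_re_inner u := norm_sq_eq_re_inner (𝕜 := ℝ) (toGraph A u)
  conj_inner_symm u v := inner_conj_symm (toGraph A u) (toGraph A v)
  add_left u v w := by simp only [map_add, inner_add_left]
  smul_left u v r := by simp only [map_smul, inner_smul_left]

theorem norm_sq (u : GraphDomain A) : ‖u‖ ^ 2 = ‖incl A u‖ ^ 2 + ‖op A u‖ ^ 2 := by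
  have h : ‖u‖ = ‖toGraph A u‖ := rfl
  rw [h, WithLp.prod_norm_sq_eq_of_L2]
  rfl

end GraphDomain

/-! ### Sobolev spaces on the half-line and the Dirichlet Laplacian -/

/-- Lebesgue measure on `ℝ₊ = (0, ∞)`. -/
abbrev halfLine : Measure ℝ := volume.restrict (Ioi 0)

/-- The real Hilbert space `L²(ℝ₊)`. -/
abbrev L2half : Type := Lp ℝ 2 halfLine

/-- Test functions in `C_c^∞((0, ∞))`. -/
structure IsTestFun (φ : ℝ → ℝ) : Prop where
  smooth : ContDiff ℝ ∞ φ
  compact : HasCompactSupport φ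
  support : tsupport φ ⊆ Ioi 0

/-- `g` is the weak derivative of `f` on `(0, ∞)`. -/
def HasWeakDeriv (f g : L2half) : Prop :=
  ∀ φ : ℝ → ℝ, IsTestFun φ →
    ∫ x, f x * deriv φ x ∂halfLine = -∫ x, g x * φ x ∂halfLine

theorem IsTestFun.deriv {φ : ℝ → ℝ} (h : IsTestFun φ) : IsTestFun (deriv φ) where
  smooth := (contDiff_infty_iff_deriv.mp h.smooth).2
  compact := h.compact.deriv
  support := closure_minimal ((support_deriv_subset (f := φ))) (isClosed_tsupport φ) |>.trans h.support

theorem IsTestFun.memLp {φ : ℝ → ℝ} (h : IsTestFun φ) : MemLp φ 2 halfLine :=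
  (h.smooth.continuous.memLp_of_hasCompactSupport h.compact).restrict _

theorem IsTestFun.integrable_mul {φ : ℝ → ℝ} (h : IsTestFun φ) (f : L2half) :
    Integrable (fun x => f x * φ x) halfLine :=
  (Lp.memLp f).integrable_mul h.memLp

theorem HasWeakDeriv.add {f g f' g' : L2half} (h : HasWeakDeriv f g) (h' : HasWeakDeriv f' g') :
    HasWeakDeriv (f + f') (g + g') := by
  intro φ hφ
  have e1 : ∫ x, (f + f') x * _root_.deriv φ x ∂halfLine =
      ∫ x, (f x * _root_.deriv φ x + f' x * _root_.deriv φ x) ∂halfLine := by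
    refine integral_congr_ae ?_
    filter_upwards [Lp.coeFn_add f f'] with x hx
    rw [hx, Pi.add_apply, add_mul]
  have e2 : ∫ x, (g + g') x * φ x ∂halfLine =
      ∫ x, (g x * φ x + g' x * φ x) ∂halfLine := by
    refine integral_congr_ae ?_
    filter_upwards [Lp.coeFn_add g g'] with x hx
    rw [hx, Pi.add_apply, add_mul]
  rw [e1, e2, integral_add (hφ.deriv.integrable_mul f) (hφ.deriv.integrable_mul f'),
    integral_add (hφ.integrable_mul g) (hφ.integrable_mul g'), h φ hφ, h' φ hφ]
  ring

theorem HasWeakDeriv.smul {f g : L2half} (c : ℝ) (h : HasWeakDeriv f g) :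
    HasWeakDeriv (c • f) (c • g) := by
  intro φ hφ
  have e1 : ∫ x, (c • f) x * _root_.deriv φ x ∂halfLine =
      ∫ x, c * (f x * _root_.deriv φ x) ∂halfLine := by
    refine integral_congr_ae ?_
    filter_upwards [Lp.coeFn_smul c f] with x hx
    rw [hx, Pi.smul_apply, smul_eq_mul, mul_assoc]
  have e2 : ∫ x, (c • g) x * φ x ∂halfLine = ∫ x, c * (g x * φ x) ∂halfLine := by
    refine integral_congr_ae ?_
    filter_upwards [Lp.coeFn_smul c g] with x hx
    rw [hx, Pi.smul_apply, smul_eq_mul, mul_assoc]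
  rw [e1, e2, integral_const_mul, integral_const_mul, h φ hφ]
  ring

theorem HasWeakDeriv.zero : HasWeakDeriv 0 0 := by
  have h : ∀ c : ℝ → ℝ, ∫ x, (0 : L2half) x * c x ∂halfLine = 0 := fun c => by
    rw [integral_eq_zero_of_ae]
    filter_upwards [Lp.coeFn_zero ℝ 2 halfLine] with x hx
    rw [hx, Pi.zero_apply, zero_mul]
  intro φ _
  rw [h, h, neg_zero]

theorem HasWeakDeriv.unique {f g g' : L2half} (h : HasWeakDeriv f g) (h' : HasWeakDeriv f g') :
    g = g' := by
  have hd : HasWeakDeriv 0 (g - g') := by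
    have := h.add (h'.smul (-1))
    simpa [sub_eq_add_neg] using this
  have hz : ∀ᵐ x ∂(volume : Measure ℝ), x ∈ Ioi (0 : ℝ) → (g - g' : L2half) x = 0 := by
    refine isOpen_Ioi.ae_eq_zero_of_integral_contDiff_smul_eq_zero ?_ ?_
    · refine locallyIntegrableOn_of_locallyIntegrable_restrict ?_
      exact (Lp.memLp (g - g')).locallyIntegrable (by norm_num)
    · intro φ h1 h2 h3
      have hφ := hd φ ⟨h1, h2, h3⟩
      have h0 : ∫ x, (0 : L2half) x * _root_.deriv φ x ∂halfLine = 0 := by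
        rw [integral_eq_zero_of_ae]
        filter_upwards [Lp.coeFn_zero ℝ 2 halfLine] with x hx
        rw [hx, Pi.zero_apply, zero_mul]
      rw [h0, zero_eq_neg] at hφ
      rw [← hφ, ← setIntegral_eq_integral_of_forall_compl_eq_zero (s := Ioi 0)]
      · simp only [smul_eq_mul, mul_comm]
      · intro x hx
        rw [image_eq_zero_of_notMem_tsupport (fun hx' => hx (h3 hx')), zero_smul]
  have hz' : (g - g' : L2half) =ᵐ[halfLine] 0 := (ae_restrict_iff' measurableSet_Ioi).mpr hz
  exact sub_eq_zero.mp ((Lp.eq_zero_iff_ae_eq_zero).mpr hz')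

/-- The Sobolev space `H²(ℝ₊)`. -/
def H2 : Submodule ℝ L2half where
  carrier := {f | ∃ g h, HasWeakDeriv f g ∧ HasWeakDeriv g h}
  zero_mem' := ⟨0, 0, .zero, .zero⟩
  add_mem' := by
    rintro f f' ⟨g, h, h1, h2⟩ ⟨g', h', h1', h2'⟩
    exact ⟨g + g', h + h', h1.add h1', h2.add h2'⟩
  smul_mem' := by
    rintro c f ⟨g, h, h1, h2⟩
    exact ⟨c • g, c • h, h1.smul c, h2.smul c⟩

/-- The pairs `(φ, φ')` in `L²(ℝ₊) × L²(ℝ₊)` with `φ ∈ C_c^∞((0, ∞))`. -/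
def testPairs : Submodule ℝ (L2half × L2half) where
  carrier := {p | ∃ φ : ℝ → ℝ, IsTestFun φ ∧ p.1 =ᵐ[halfLine] φ ∧ p.2 =ᵐ[halfLine] deriv φ}
  zero_mem' := by
    refine ⟨0, ⟨contDiff_const, HasCompactSupport.zero, by simp⟩, Lp.coeFn_zero ℝ 2 _, ?_⟩
    filter_upwards [Lp.coeFn_zero ℝ 2 halfLine] with x hx
    simpa using hx
  add_mem' := by
    rintro p q ⟨φ, hφ, h1, h2⟩ ⟨ψ, hψ, k1, k2⟩
    refine ⟨φ + ψ, ⟨hφ.smooth.add hψ.smooth, hφ.compact.add hψ.compact,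
      (tsupport_add φ ψ).trans (union_subset hφ.support hψ.support)⟩, ?_, ?_⟩
    · filter_upwards [Lp.coeFn_add p.1 q.1, h1, k1] with x hx h k
      rw [Prod.fst_add, hx, Pi.add_apply, Pi.add_apply, h, k]
    · filter_upwards [Lp.coeFn_add p.2 q.2, h2, k2] with x hx h k
      rw [Prod.snd_add, hx, Pi.add_apply, h, k, deriv_add
        (hφ.smooth.differentiable (by simp) x) (hψ.smooth.differentiable (by simp) x)]
  smul_mem' := by
    rintro c p ⟨φ, hφ, h1, h2⟩
    refine ⟨c • φ, ⟨hφ.smooth.const_smul c, hφ.compact.smul_left (f := fun _ => c),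
      (closure_mono (Function.support_const_smul_subset c φ)).trans hφ.support⟩, ?_, ?_⟩
    · filter_upwards [Lp.coeFn_smul c p.1, h1] with x hx h
      rw [Prod.smul_fst, hx, Pi.smul_apply, Pi.smul_apply, h]
    · filter_upwards [Lp.coeFn_smul c p.2, h2] with x hx h
      rw [Prod.smul_snd, hx, Pi.smul_apply, h, deriv_const_smul c
        (hφ.smooth.differentiable (by simp) x)]

/-- The Sobolev space `H¹₀(ℝ₊)`, the closure of `C_c^∞((0, ∞))` in `H¹(ℝ₊)`: here `H¹(ℝ₊)` is
seen as the closed subspace of all pairs `(f, f')` in `L²(ℝ₊) × L²(ℝ₊)`. -/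
def H10 : Submodule ℝ L2half :=
  testPairs.topologicalClosure.map (LinearMap.fst ℝ L2half L2half)

theorem HasWeakDeriv.unique2 {f g h g' h' : L2half} (h1 : HasWeakDeriv f g)
    (h2 : HasWeakDeriv g h) (h1' : HasWeakDeriv f g') (h2' : HasWeakDeriv g' h') : h = h' := by
  obtain rfl := h1.unique h1'
  exact h2.unique h2'

/-- The second weak derivative `H²(ℝ₊) → L²(ℝ₊)`. -/
def weakDeriv2 : H2 →ₗ[ℝ] L2half where
  toFun f := f.2.choose_spec.choose
  map_add' f f' := by
    have k := f.2.choose_spec.choose_spec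
    have k' := f'.2.choose_spec.choose_spec
    have l := (f + f').2.choose_spec.choose_spec
    exact l.1.unique2 l.2 (k.1.add k'.1) (k.2.add k'.2)
  map_smul' c f := by
    have k := f.2.choose_spec.choose_spec
    have l := (c • f).2.choose_spec.choose_spec
    exact l.1.unique2 l.2 (k.1.smul c) (k.2.smul c)

theorem weakDeriv2_eq (f : H2) {g h : L2half} (h1 : HasWeakDeriv f g) (h2 : HasWeakDeriv g h) :
    weakDeriv2 f = h := by
  have k := f.2.choose_spec.choose_spec
  exact k.1.unique2 k.2 h1 h2

/-- The Dirichlet Laplacian on `L²(ℝ₊)`, with domain `H²(ℝ₊) ∩ H¹₀(ℝ₊)`. -/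
def dirichletLaplacian : L2half →ₗ.[ℝ] L2half where
  domain := H2 ⊓ H10
  toFun := weakDeriv2 ∘ₗ Submodule.inclusion inf_le_left

/-! ### The operator `𝒜` -/

/-- The Hilbert space `𝓛² = L²(ℝ₊) ⊕ L²(ℝ₊) ⊕ ℝ`. -/
abbrev L2sum : Type := WithLp 2 (L2half × WithLp 2 (L2half × ℝ))

/-- The component `u₁` of `(u₁, u₂, u₃)`. -/
def pr1 : L2sum →ₗ[ℝ] L2half := WithLp.fstₗ 2 ℝ L2half (WithLp 2 (L2half × ℝ))

/-- The component `u₂` of `(u₁, u₂, u₃)`. -/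
def pr2 : L2sum →ₗ[ℝ] L2half :=
  WithLp.fstₗ 2 ℝ L2half ℝ ∘ₗ WithLp.sndₗ 2 ℝ L2half (WithLp 2 (L2half × ℝ))

/-- The component `u₃` of `(u₁, u₂, u₃)`. -/
def pr3 : L2sum →ₗ[ℝ] ℝ :=
  WithLp.sndₗ 2 ℝ L2half ℝ ∘ₗ WithLp.sndₗ 2 ℝ L2half (WithLp 2 (L2half × ℝ))

/-- The operator `𝒜 = diag(η₊ Δ, η₋ Δ, 0) - c id` on `𝓛²`, where `Δ` is the Dirichlet Laplacian;
its domain is `(H²(ℝ₊) ∩ H¹₀(ℝ₊)) × (H²(ℝ₊) ∩ H¹₀(ℝ₊)) × ℝ`. -/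
def opA (ηp ηm c : ℝ) : L2sum →ₗ.[ℝ] L2sum where
  domain := (H2 ⊓ H10).comap pr1 ⊓ (H2 ⊓ H10).comap pr2
  toFun :=
    { toFun := fun u => WithLp.toLp 2
        (ηp • dirichletLaplacian ⟨pr1 u, u.2.1⟩, WithLp.toLp 2
          (ηm • dirichletLaplacian ⟨pr2 u, u.2.2⟩, (0 : ℝ))) - c • (u : L2sum)
      map_add' := by
        intro u v
        have h1 : dirichletLaplacian ⟨pr1 ↑(u + v), (u + v).2.1⟩ =
            dirichletLaplacian ⟨pr1 u, u.2.1⟩ + dirichletLaplacian ⟨pr1 v, v.2.1⟩ :=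
          dirichletLaplacian.map_add ⟨pr1 u, u.2.1⟩ ⟨pr1 v, v.2.1⟩
        have h2 : dirichletLaplacian ⟨pr2 ↑(u + v), (u + v).2.2⟩ =
            dirichletLaplacian ⟨pr2 u, u.2.2⟩ + dirichletLaplacian ⟨pr2 v, v.2.2⟩ :=
          dirichletLaplacian.map_add ⟨pr2 u, u.2.2⟩ ⟨pr2 v, v.2.2⟩
        have h3 : ∀ a a' b b' : L2half,
            (WithLp.toLp 2 (a + a', WithLp.toLp 2 (b + b', (0 : ℝ))) : L2sum) =
            WithLp.toLp 2 (a, WithLp.toLp 2 (b, (0 : ℝ))) +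
            WithLp.toLp 2 (a', WithLp.toLp 2 (b', (0 : ℝ))) := by
          intro a a' b b'
          rw [← WithLp.toLp_add, Prod.mk_add_mk, ← WithLp.toLp_add, Prod.mk_add_mk, add_zero]
        rw [h1, h2, smul_add, smul_add, h3, Submodule.coe_add, smul_add]
        abel
      map_smul' := by
        intro r u
        have h1 : dirichletLaplacian ⟨pr1 ↑(r • u), (r • u).2.1⟩ =
            r • dirichletLaplacian ⟨pr1 u, u.2.1⟩ :=
          dirichletLaplacian.map_smul r ⟨pr1 u, u.2.1⟩
        have h2 : dirichletLaplacian ⟨pr2 ↑(r • u), (r • u).2.2⟩ =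
            r • dirichletLaplacian ⟨pr2 u, u.2.2⟩ :=
          dirichletLaplacian.map_smul r ⟨pr2 u, u.2.2⟩
        have h3 : ∀ a b : L2half,
            (WithLp.toLp 2 (r • a, WithLp.toLp 2 (r • b, (0 : ℝ))) : L2sum) =
            r • WithLp.toLp 2 (a, WithLp.toLp 2 (b, (0 : ℝ))) := by
          intro a b
          rw [← WithLp.toLp_smul, Prod.smul_mk, ← WithLp.toLp_smul, Prod.smul_mk, smul_zero]
        rw [h1, h2, smul_comm ηp r, smul_comm ηm r, h3, Submodule.coe_smul, smul_comm c r,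
          ← smul_sub, RingHom.id_apply] }

/-! ### Coefficients -/

/-- The Hilbert space `U = L²(ℝ)`. -/
abbrev NoiseSpace : Type := Lp ℝ 2 (volume : Measure ℝ)

/-- The mixed partial derivative `∂ⁱ⁺ʲ σ / ∂xⁱ ∂yʲ` at `(x, y)`. -/
def partialDeriv (i j : ℕ) (σ : ℝ → ℝ → ℝ) (x y : ℝ) : ℝ :=
  iteratedDeriv i (fun x' => iteratedDeriv j (σ x') y) x

/-- The assumption on the coefficients `σ₊` and `σ₋`. -/
structure SigmaAssumption (σ : ℝ → ℝ → ℝ) : Prop where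
  contDiff : ContDiff ℝ 2 (fun p : ℝ × ℝ => σ p.1 p.2)
  /-- `|∂ⁱₓ∂ʲ_y σ(x, y)| ≤ a(|x|) + b(y)|y|` if `j = 0` and `≤ b(y)` if `j ≠ 0`, with
  `a ∈ L²(ℝ₊)` and `0 ≤ b ∈ L^∞_loc(ℝ)` depending on `(i, j)`. -/
  growth : ∀ i j : ℕ, i + j ≤ 2 → ∃ a b : ℝ → ℝ,
    MemLp a 2 (volume.restrict (Ioi 0)) ∧
    (∀ y, 0 ≤ b y) ∧ (∀ K : Set ℝ, IsCompact K → MemLp b ⊤ (volume.restrict K)) ∧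
    ∀ x y, |partialDeriv i j σ x y| ≤ if j = 0 then a |x| + b y * |y| else b y
  /-- `σ` and its partial derivatives are locally Lipschitz in `y`, uniformly in `x`. -/
  lipschitz : ∀ i j : ℕ, i + j ≤ 2 → ∀ r : ℝ, ∃ L : ℝ, ∀ x y z : ℝ, |y| ≤ r → |z| ≤ r →
    |partialDeriv i j σ x y - partialDeriv i j σ x z| ≤ L * |y - z|
  boundary : σ 0 0 = 0

/-- The assumption on the integral kernel `ζ`. -/
structure ZetaAssumption (ζ : ℝ → ℝ → ℝ) : Prop where
  contDiff : ∀ y, ContDiff ℝ 3 (fun x => ζ x y)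
  memLp : ∀ i ≤ 3, ∀ x, MemLp (fun y => iteratedDeriv i (fun x' => ζ x' y) x) 2 volume
  bounded : ∀ i ≤ 3, ⨆ x, eLpNorm (fun y => iteratedDeriv i (fun x' => ζ x' y) x) 2 volume < ⊤

/-- The integral operator `T_ζ w (x) = ∫ ζ(x, y) w(y) dy`. -/
def opT (ζ : ℝ → ℝ → ℝ) (w : NoiseSpace) (x : ℝ) : ℝ := ∫ y, ζ x y * w y

/-- `v ∈ 𝓛²` is the element `C(u) w`, that is, `v₁(x) = σ₊(x, u₁(x)) (T_ζ w)(u₃ + x)` and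
`v₂(x) = σ₋(-x, u₂(x)) (T_ζ w)(u₃ - x)` for almost all `x > 0`, and `v₃ = 0`. -/
def IsNoiseCoeff (σp σm ζ : ℝ → ℝ → ℝ) (u : L2sum) (w : NoiseSpace) (v : L2sum) : Prop :=
  (pr1 v =ᵐ[halfLine] fun x => σp x (pr1 u x) * opT ζ w (pr3 u + x)) ∧
  (pr2 v =ᵐ[halfLine] fun x => σm (-x) (pr2 u x) * opT ζ w (pr3 u - x)) ∧
  pr3 v = 0

end

/-! With Z(x) = ζ(x,·) ∈ U one has (T_ζ w)(x) = ⟪w, Z(x)⟫, so each of the first two components of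
C(u)w is x ↦ ⟪w, Φ(u)(x)⟫ for the U-valued function Φ(u)(x) = σ(x, uᵢ(x)) Z(u₃ ± x), where σ is σ₊
or the reflection of σ₋. Bessel's inequality at each x, integrated over x, bounds the
Hilbert-Schmidt norm of w ↦ ⟪w, Φ(·)⟫ by the norm of Φ in L²(ℝ₊; U) (`sum_norm_pairing_sq_le`). When
the third component vanishes, the graph norm is controlled by the L² norms of the components and of
their second derivatives (`exists_norm_sq_le`). So it suffices that Φ(u) and its second x-derivative
Θ(u) depend on u in a locally Lipschitz way in L²(ℝ₊; U), and that every ⟪w, Φ(u)⟫ lies in H² ∩ H¹₀.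

This is `IsSigmaCoeff.exists_superposition`. The graph norm controls uᵢ and uᵢ'' in L²;
interpolation then controls uᵢ' in L², and the one-dimensional Sobolev inequality puts uᵢ and uᵢ' in
L^∞. Hence every term of Θ(u) is a product of L^∞ factors with one L² factor, including the critical
one ∂_yyσ · (uᵢ')². Being bounded and Lipschitz on bounded sets (`LocLip`) is stable under sums and
such products, so each factor can be checked separately. For the shift by u₃ this needs Z, Z', Z''
bounded and Lipschitz as curves in L²(ℝ), which the bounds on three derivatives of ζ provide
(`ZetaAssumption.exists_curve`).

Membership in H² ∩ H¹₀ is read off absolutely continuous representatives: they differentiate by the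
classical product and chain rules, and H¹₀ is the condition of vanishing at 0
(`isPrim_zero_eq_zero_of_mem_H10`, `mem_H10_of_isPrim`), which is preserved because σ(0,0) = 0. -/

/-! ### Absolutely continuous functions on `[0, ∞)` -/

/-- `F` is locally absolutely continuous on `[0, ∞)`, with derivative `f` almost everywhere. -/
structure IsPrim (F f : ℝ → ℝ) : Prop where
  ac : ∀ R, AbsolutelyContinuousOnInterval F 0 R
  deriv : ∀ᵐ x ∂halfLine, HasDerivAt F (f x) x

namespace IsPrim

variable {F G f g : ℝ → ℝ}

theorem add (hF : IsPrim F f) (hG : IsPrim G g) :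
    IsPrim (fun x => F x + G x) (fun x => f x + g x) where
  ac R := (hF.ac R).add (hG.ac R)
  deriv := by
    filter_upwards [hF.deriv, hG.deriv] with x h1 h2 using h1.add h2

theorem mul (hF : IsPrim F f) (hG : IsPrim G g) :
    IsPrim (fun x => F x * G x) (fun x => f x * G x + F x * g x) where
  ac R := (hF.ac R).mul (hG.ac R)
  deriv := by
    filter_upwards [hF.deriv, hG.deriv] with x h1 h2 using h1.mul h2

theorem congr_deriv (hF : IsPrim F f) (h : f =ᵐ[halfLine] g) : IsPrim F g where
  ac := hF.ac
  deriv := by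
    filter_upwards [hF.deriv, h] with x h1 h2 using h2 ▸ h1

theorem of_contDiff (hF : ContDiff ℝ 1 F) : IsPrim F (_root_.deriv F) where
  ac R := hF.contDiffOn.absolutelyContinuousOnInterval
  deriv := .of_forall fun x => (hF.differentiable (by simp) x).hasDerivAt

theorem const (c : ℝ) : IsPrim (fun _ => c) (fun _ => 0) := by
  simpa using of_contDiff (F := fun _ : ℝ => c) contDiff_const

theorem of_integral (hg : LocallyIntegrable g) : IsPrim (fun x => ∫ t in (0 : ℝ)..x, g t) g where
  ac R := IntervalIntegrable.absolutelyContinuousOnInterval_intervalIntegral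
    (intervalIntegrable_iff.mpr
      ((hg.integrableOn_isCompact isCompact_uIcc).mono_set uIoc_subset_uIcc)) (by simp)
  deriv := ae_restrict_of_ae (by filter_upwards [LocallyIntegrable.ae_hasDerivAt_integral hg] with x hx using hx 0)

theorem ae_deriv_eq (hF : IsPrim F f) {R : ℝ} (hR : 0 ≤ R) :
    _root_.deriv F =ᵐ[volume.restrict (uIoc 0 R)] f := by
  rw [uIoc_of_le hR]
  filter_upwards [ae_restrict_of_ae_restrict_of_subset (Ioc_subset_Ioi_self) hF.deriv] with x hx
  exact hx.deriv

theorem intervalIntegrable (hF : IsPrim F f) {R : ℝ} (hR : 0 ≤ R) :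
    IntervalIntegrable f volume 0 R :=
  (hF.ac R).intervalIntegrable_deriv.congr_ae (hF.ae_deriv_eq hR)

theorem integral_eq (hF : IsPrim F f) {R : ℝ} (hR : 0 ≤ R) :
    ∫ x in (0 : ℝ)..R, f x = F R - F 0 := by
  rw [← (hF.ac R).integral_deriv_eq_sub]
  refine (intervalIntegral.integral_congr_ae_restrict (hF.ae_deriv_eq hR)).symm

theorem integral_eq' (hF : IsPrim F f) {a b : ℝ} (ha : 0 ≤ a) (hb : 0 ≤ b) :
    ∫ x in a..b, f x = F b - F a := by
  rw [← intervalIntegral.integral_add_adjacent_intervals (hF.intervalIntegrable ha).symm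
    (hF.intervalIntegrable hb), intervalIntegral.integral_symm, hF.integral_eq ha,
    hF.integral_eq hb]
  ring

theorem continuousOn (hF : IsPrim F f) : ContinuousOn F (Ici 0) := by
  intro x hx
  have h := (hF.ac (x + 1)).continuousOn x (by
    rw [uIcc_of_le (by linarith [mem_Ici.mp hx])]; exact ⟨hx, by linarith⟩)
  rw [uIcc_of_le (by linarith [mem_Ici.mp hx])] at h
  refine h.mono_of_mem_nhdsWithin ?_
  filter_upwards [self_mem_nhdsWithin, mem_nhdsWithin_of_mem_nhds (Iio_mem_nhds (lt_add_one x))]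
    with y hy hy' using ⟨hy, le_of_lt hy'⟩

end IsPrim

/-- The fundamental theorem of calculus on `[0, ∞)` for an integrable function with integrable
derivative. -/
theorem IsPrim.integral_halfLine {F f : ℝ → ℝ} (hF : IsPrim F f) (hF1 : Integrable F halfLine)
    (hf : Integrable f halfLine) : ∫ x, f x ∂halfLine = - F 0 := by
  have h1 := MeasureTheory.intervalIntegral_tendsto_integral_Ioi 0 hf Filter.tendsto_id
  have h2 : Filter.Tendsto F Filter.atTop (nhds (F 0 + ∫ x, f x ∂halfLine)) := by
    refine (h1.const_add (F 0)).congr' ?_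
    filter_upwards [Filter.eventually_ge_atTop 0] with R hR
    rw [id, hF.integral_eq hR]; ring
  have h3 : F 0 + ∫ x, f x ∂halfLine = 0 := by
    -- A nonzero limit at infinity would keep |F| above a positive constant on a half-line, against
    -- integrability.
    by_contra h0
    have hev := h2.eventually_ne h0
    have habs : ∀ᶠ R in Filter.atTop, |F 0 + ∫ x, f x ∂halfLine| / 2 ≤ |F R| := by
      filter_upwards [h2.abs.eventually_const_lt (half_lt_self (abs_pos.mpr h0))] with R hR
        using hR.le
    obtain ⟨R, hR⟩ := Filter.eventually_atTop.mp habs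
    have hc : IntegrableOn (fun _ : ℝ => |F 0 + ∫ x, f x ∂halfLine| / 2) (Ioi (max R 0)) := by
      refine Integrable.mono' (g := fun x => |F x|) ?_ aestronglyMeasurable_const ?_
      · exact (hF1.mono_measure (Measure.restrict_mono (Ioi_subset_Ioi (le_max_right _ _)) le_rfl)).abs
      · filter_upwards [ae_restrict_mem measurableSet_Ioi] with x hx
        rw [Real.norm_eq_abs, abs_of_nonneg (by positivity)]
        exact hR x ((le_max_left _ _).trans (le_of_lt hx))
    rw [integrableOn_const_iff] at hc
    rcases hc with hc | hc
    · have : (0:ℝ) < |F 0 + ∫ x, f x ∂halfLine| / 2 := by positivity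
      exact this.ne' (enorm_eq_zero.mp hc)
    · simp at hc
  linarith

theorem IsTestFun.eq_zero {φ : ℝ → ℝ} (h : IsTestFun φ) {x : ℝ} (hx : x ≤ 0) : φ x = 0 :=
  image_eq_zero_of_notMem_tsupport fun h' => not_lt.mpr hx (h.support h')

theorem IsTestFun.contDiff_one {φ : ℝ → ℝ} (h : IsTestFun φ) : ContDiff ℝ 1 φ :=
  h.smooth.of_le (by simp)

theorem IsPrim.locallyIntegrableOn {F f : ℝ → ℝ} (hF : IsPrim F f) :
    LocallyIntegrableOn f (Ioi 0) := by
  intro x hx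
  refine ⟨Ioc 0 (x + 1), mem_nhdsWithin_of_mem_nhds (Ioc_mem_nhds hx (lt_add_one x)), ?_⟩
  exact (intervalIntegrable_iff_integrableOn_Ioc_of_le (by linarith [mem_Ioi.mp hx])).mp
    (hF.intervalIntegrable (by linarith [mem_Ioi.mp hx]))

theorem IsTestFun.integrable_mul_of_locallyIntegrableOn {φ f : ℝ → ℝ} (h : IsTestFun φ)
    (hf : LocallyIntegrableOn f (Ioi 0)) : Integrable (fun x => f x * φ x) halfLine := by
  have h1 : IntegrableOn (fun x => f x * φ x) (tsupport φ) :=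
    (hf.integrableOn_compact_subset h.support h.compact).mul_continuousOn
      h.smooth.continuous.continuousOn h.compact
  have h2 : Integrable (fun x => f x * φ x) :=
    (integrableOn_iff_integrable_of_support_subset (by
      intro x hx
      exact subset_tsupport φ (right_ne_zero_of_mul hx))).mp h1
  exact h2.restrict

/-- No boundary term appears because φ(0) = 0; so F may take any value at 0. -/
theorem IsPrim.integral_mul_deriv {F f φ : ℝ → ℝ} (hF : IsPrim F f) (hφ : IsTestFun φ) :
    ∫ x, F x * _root_.deriv φ x ∂halfLine = -∫ x, f x * φ x ∂halfLine := by
  have hFl : LocallyIntegrableOn F (Ioi 0) :=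
    (hF.continuousOn.mono Ioi_subset_Ici_self).locallyIntegrableOn measurableSet_Ioi
  have hfl := hF.locallyIntegrableOn
  have i1 := hφ.deriv.integrable_mul_of_locallyIntegrableOn hFl
  have i2 := hφ.integrable_mul_of_locallyIntegrableOn hfl
  have i3 := hφ.integrable_mul_of_locallyIntegrableOn hFl
  have h := (hF.mul (.of_contDiff hφ.contDiff_one)).integral_halfLine i3 (i2.add i1)
  rw [integral_add i2 i1, hφ.eq_zero le_rfl] at h
  linarith

/-! ### Weak derivatives and absolutely continuous representatives. -/

theorem HasWeakDeriv.of_isPrim {f g : L2half} {F : ℝ → ℝ} (hf : f =ᵐ[halfLine] F)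
    (hF : IsPrim F g) : HasWeakDeriv f g := by
  intro φ hφ
  rw [← hF.integral_mul_deriv hφ]
  refine integral_congr_ae ?_
  filter_upwards [hf] with x hx
  rw [hx]

theorem locallyIntegrable_indicator_halfLine (g : L2half) :
    LocallyIntegrable ((Ioi (0 : ℝ)).indicator g) := by
  have h : MemLp ((Ioi (0 : ℝ)).indicator g) 2 volume :=
    (memLp_indicator_iff_restrict measurableSet_Ioi).mpr (Lp.memLp g)
  exact h.locallyIntegrable (by norm_num)

theorem exists_isPrim (g : L2half) : ∃ F : ℝ → ℝ, Continuous F ∧ F 0 = 0 ∧ IsPrim F g := by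
  have hg := locallyIntegrable_indicator_halfLine g
  refine ⟨fun x => ∫ t in (0 : ℝ)..x, (Ioi (0 : ℝ)).indicator g t, ?_, by simp, ?_⟩
  · refine intervalIntegral.continuous_primitive (fun a b => ?_) 0
    exact intervalIntegrable_iff.mpr
      ((hg.integrableOn_isCompact isCompact_uIcc).mono_set uIoc_subset_uIcc)
  · refine (IsPrim.of_integral hg).congr_deriv ?_
    exact indicator_ae_eq_restrict measurableSet_Ioi

theorem exists_isTestFun_integral_eq_one : ∃ ψ : ℝ → ℝ, IsTestFun ψ ∧ ∫ x, ψ x = 1 := by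
  let b : ContDiffBump (2 : ℝ) := ⟨1 / 2, 1, by norm_num, by norm_num⟩
  refine ⟨b.normed volume, ⟨b.contDiff_normed, b.hasCompactSupport_normed, ?_⟩,
    b.integral_normed⟩
  rw [b.tsupport_normed_eq]
  intro x hx
  have := (abs_le.mp (Real.dist_eq x 2 ▸ Metric.mem_closedBall.mp hx)).1
  simp only [mem_Ioi]
  change -1 ≤ x - 2 at this
  linarith

theorem IsTestFun.sub_smul {φ ψ : ℝ → ℝ} (h : IsTestFun φ) (h' : IsTestFun ψ) (c : ℝ) :
    IsTestFun (fun x => φ x - c * ψ x) where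
  smooth := h.smooth.sub (contDiff_const.mul h'.smooth)
  compact := h.compact.sub h'.compact.mul_left
  support := by
    refine (tsupport_sub φ (fun x => c * ψ x)).trans (union_subset h.support ?_)
    exact (tsupport_mul_subset_right (f := fun _ : ℝ => c) (g := ψ)).trans h'.support

/-- The primitive from 0 vanishes to the left of the support, and zero mean makes it vanish to the
right as well, so it is again supported in a compact subset of (0, ∞). -/
theorem IsTestFun.exists_primitive {φ : ℝ → ℝ} (h : IsTestFun φ) (h0 : ∫ x, φ x = 0) :
    ∃ χ, IsTestFun χ ∧ _root_.deriv χ = φ := by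
  have hc := h.smooth.continuous
  obtain ⟨a, b, ha, hb⟩ : ∃ a b : ℝ, 0 < a ∧ tsupport φ ⊆ Icc a b := by
    rcases (tsupport φ).eq_empty_or_nonempty with he | hne
    · exact ⟨1, 1, one_pos, by simp [he]⟩
    · obtain ⟨a, ha, ha'⟩ := h.compact.isCompact.exists_isLeast hne
      obtain ⟨b, hb, hb'⟩ := h.compact.isCompact.exists_isGreatest hne
      exact ⟨a, b, h.support ha, fun x hx => ⟨ha' hx, hb' hx⟩⟩
  have hz : ∀ x, x ∉ Icc a b → φ x = 0 := fun x hx =>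
    image_eq_zero_of_notMem_tsupport fun h' => hx (hb h')
  let χ : ℝ → ℝ := fun x => ∫ t in (0 : ℝ)..x, φ t
  have hd : ∀ x, HasDerivAt χ (φ x) x := fun x => (hc.integral_hasStrictDerivAt 0 x).hasDerivAt
  have hd' : _root_.deriv χ = φ := funext fun x => (hd x).deriv
  have hsupp : Function.support χ ⊆ Icc a b := by
    intro x hx
    by_contra hx'
    refine hx ?_
    change ∫ t in (0 : ℝ)..x, φ t = 0
    rcases lt_or_ge x a with h1 | h1
    · refine intervalIntegral.integral_zero_ae (.of_forall fun t ht => hz t fun h' => ?_)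
      exact absurd (ht.2.trans_lt (max_lt ha h1)) (not_lt.mpr h'.1)
    · have h2 : b < x := by
        by_contra h3
        exact hx' ⟨h1, not_lt.mp h3⟩
      rw [intervalIntegral.integral_of_le (ha.le.trans h1)]
      refine Eq.trans ?_ h0
      refine setIntegral_eq_integral_of_forall_compl_eq_zero fun t ht => hz t fun h' => ht ?_
      exact ⟨ha.trans_le h'.1, h'.2.trans h2.le⟩
  refine ⟨χ, ⟨?_, ?_, ?_⟩, hd'⟩
  · exact contDiff_infty_iff_deriv.mpr ⟨fun x => (hd x).differentiableAt, by rw [hd']; exact h.smooth⟩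
  · exact HasCompactSupport.of_support_subset_isCompact isCompact_Icc hsupp
  · exact (closure_minimal hsupp isClosed_Icc).trans fun x hx => ha.trans_le hx.1

theorem IsTestFun.integral_halfLine {φ : ℝ → ℝ} (h : IsTestFun φ) :
    ∫ x, φ x ∂halfLine = ∫ x, φ x :=
  setIntegral_eq_integral_of_forall_compl_eq_zero fun _ hx => h.eq_zero (not_lt.mp hx)

/-- An element of `L²(ℝ₊)` with a weak derivative has an absolutely continuous representative. -/
theorem HasWeakDeriv.exists_isPrim {f g : L2half} (h : HasWeakDeriv f g) :
    ∃ F : ℝ → ℝ, Continuous F ∧ f =ᵐ[halfLine] F ∧ IsPrim F g := by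
  obtain ⟨F, hFc, -, hF⟩ := _root_.exists_isPrim g
  obtain ⟨ψ, hψ, hψ1⟩ := exists_isTestFun_integral_eq_one
  have hfl : LocallyIntegrableOn f (Ioi 0) :=
    locallyIntegrableOn_of_locallyIntegrable_restrict
      ((Lp.memLp f).locallyIntegrable (by norm_num))
  have hFl : LocallyIntegrableOn F (Ioi 0) := hFc.locallyIntegrable.locallyIntegrableOn _
  have hi : ∀ φ, IsTestFun φ → Integrable (fun x => (f x - F x) * φ x) halfLine := fun φ hφ =>
    hφ.integrable_mul_of_locallyIntegrableOn (hfl.sub hFl)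
  have h0 : ∀ φ, IsTestFun φ → ∫ x, (f x - F x) * deriv φ x ∂halfLine = 0 := by
    intro φ hφ
    have h1 := h φ hφ
    have h2 := hF.integral_mul_deriv hφ
    simp_rw [sub_mul]
    rw [integral_sub (hφ.deriv.integrable_mul_of_locallyIntegrableOn hfl)
      (hφ.deriv.integrable_mul_of_locallyIntegrableOn hFl), h1, h2, sub_self]
  -- The du Bois-Reymond argument: f - F annihilates derivatives of test functions, and φ - (∫ φ) ψ
  -- is such a derivative for every φ. Hence f - F acts on φ as the constant c.
  set c := ∫ x, (f x - F x) * ψ x ∂halfLine with hcdef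
  have hz : ∀ᵐ x ∂(volume : Measure ℝ), x ∈ Ioi (0 : ℝ) → f x - F x - c = 0 := by
    refine isOpen_Ioi.ae_eq_zero_of_integral_contDiff_smul_eq_zero ?_ ?_
    · exact (hfl.sub hFl).sub (continuous_const.locallyIntegrable.locallyIntegrableOn _)
    · intro φ h1 h2 h3
      have hφ : IsTestFun φ := ⟨h1, h2, h3⟩
      have hφi : Integrable φ := hφ.smooth.continuous.integrable_of_hasCompactSupport hφ.compact
      have hψi : Integrable ψ := hψ.smooth.continuous.integrable_of_hasCompactSupport hψ.compact
      obtain ⟨χ, hχ, hχd⟩ := (hφ.sub_smul hψ (∫ x, φ x)).exists_primitive (by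
        rw [integral_sub hφi (hψi.const_mul _), integral_const_mul, hψ1, mul_one, sub_self])
      have h4 := h0 χ hχ
      rw [hχd] at h4
      have e : ∀ x, (f x - F x) * (φ x - (∫ x, φ x) * ψ x) =
          (f x - F x) * φ x - (∫ x, φ x) * ((f x - F x) * ψ x) := fun x => by ring
      simp_rw [e] at h4
      rw [integral_sub (hi φ hφ) ((hi ψ hψ).const_mul _), integral_const_mul, ← hcdef] at h4
      rw [← setIntegral_eq_integral_of_forall_compl_eq_zero (s := Ioi 0)]
      · have e' : ∀ x, φ x • (f x - F x - c) = (f x - F x) * φ x - c * φ x := fun x => by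
          simp only [smul_eq_mul]; ring
        simp_rw [e']
        rw [integral_sub (hi φ hφ) (hφi.restrict.const_mul _), integral_const_mul,
          hφ.integral_halfLine]
        linarith
      · intro x hx
        rw [hφ.eq_zero (not_lt.mp hx), zero_smul]
  refine ⟨fun x => F x + c, hFc.add continuous_const, ?_, ?_⟩
  · filter_upwards [(ae_restrict_iff' measurableSet_Ioi).mpr hz] with x hx
    linarith
  · simpa using hF.add (.const c)

/-! ### Integration by parts and the boundary value of `H10` functions. -/

theorem norm_sq_L2half (f : L2half) : ‖f‖ ^ 2 = ∫ x, f x ^ 2 ∂halfLine := by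
  rw [← real_inner_self_eq_norm_sq, L2.inner_def]
  refine integral_congr_ae (.of_forall fun x => ?_)
  simp [sq]

theorem inner_L2half (f g : L2half) : inner ℝ f g = ∫ x, f x * g x ∂halfLine := by
  rw [L2.inner_def]
  refine integral_congr_ae (.of_forall fun x => ?_)
  simp [mul_comm]

theorem integrable_mul_L2half (f g : L2half) : Integrable (fun x => f x * g x) halfLine :=
  (Lp.memLp f).integrable_mul (Lp.memLp g)

/-- Integration by parts in `H¹(ℝ₊)`. -/
theorem inner_add_inner_eq_neg {f g p q : L2half} {F Q : ℝ → ℝ} (hf : f =ᵐ[halfLine] F)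
    (hF : IsPrim F g) (hq : q =ᵐ[halfLine] Q) (hQ : IsPrim Q p) :
    inner ℝ g q + inner ℝ f p = -(F 0 * Q 0) := by
  have h : IsPrim (fun x => F x * Q x) (fun x => g x * q x + f x * p x) := by
    refine (hF.mul hQ).congr_deriv ?_
    filter_upwards [hf, hq] with x h1 h2
    rw [h1, h2]
  rw [inner_L2half, inner_L2half,
    ← integral_add (integrable_mul_L2half _ _) (integrable_mul_L2half _ _)]
  refine h.integral_halfLine ?_ ((integrable_mul_L2half _ _).add (integrable_mul_L2half _ _))
  refine (integrable_mul_L2half f q).congr ?_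
  filter_upwards [hf, hq] with x h1 h2
  rw [h1, h2]

/-- Pairs in the closure of the test pairs pair to zero with pairs `(p, q)` such that `q' = p`. -/
theorem inner_add_inner_eq_zero_of_mem_closure {f g p q : L2half}
    (h : (f, g) ∈ testPairs.topologicalClosure) (hq : HasWeakDeriv q p) :
    inner ℝ g q + inner ℝ f p = 0 := by
  have hcl : IsClosed {x : L2half × L2half | (inner ℝ x.2 q + inner ℝ x.1 p : ℝ) = 0} :=
    isClosed_eq (by fun_prop) continuous_const
  refine closure_minimal (s := (testPairs : Set (L2half × L2half))) ?_ hcl h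
  rintro x ⟨φ, hφ, h1, h2⟩
  have h3 := hq φ hφ
  have e1 : (inner ℝ x.2 q : ℝ) = ∫ y, q y * deriv φ y ∂halfLine := by
    rw [inner_L2half]
    refine integral_congr_ae ?_
    filter_upwards [h2] with y hy
    rw [hy, mul_comm]
  have e2 : (inner ℝ x.1 p : ℝ) = ∫ y, p y * φ y ∂halfLine := by
    rw [inner_L2half]
    refine integral_congr_ae ?_
    filter_upwards [h1] with y hy
    rw [hy, mul_comm]
  simp only [mem_ofPred_eq]
  rw [e1, e2, h3, neg_add_cancel]

theorem exists_toLp_testFun {φ : ℝ → ℝ} (h : IsTestFun φ) :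
    (h.memLp.toLp φ, h.deriv.memLp.toLp (deriv φ)) ∈ testPairs :=
  ⟨φ, h, h.memLp.coeFn_toLp, h.deriv.memLp.coeFn_toLp⟩

/-- The second component of a pair in the closure of the test pairs is the weak derivative of the
first one. -/
theorem hasWeakDeriv_of_mem_closure {f g : L2half}
    (h : (f, g) ∈ testPairs.topologicalClosure) : HasWeakDeriv f g := by
  intro φ hφ
  have hw : HasWeakDeriv (hφ.memLp.toLp φ) (hφ.deriv.memLp.toLp (deriv φ)) :=
    .of_isPrim hφ.memLp.coeFn_toLp
      ((IsPrim.of_contDiff hφ.contDiff_one).congr_deriv hφ.deriv.memLp.coeFn_toLp.symm)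
  have h1 := inner_add_inner_eq_zero_of_mem_closure h hw
  rw [inner_L2half, inner_L2half] at h1
  have e1 : ∫ x, f x * deriv φ x ∂halfLine =
      ∫ x, f x * hφ.deriv.memLp.toLp (deriv φ) x ∂halfLine := by
    refine integral_congr_ae ?_
    filter_upwards [hφ.deriv.memLp.coeFn_toLp] with x hx
    rw [hx]
  have e2 : ∫ x, g x * φ x ∂halfLine = ∫ x, g x * hφ.memLp.toLp φ x ∂halfLine := by
    refine integral_congr_ae ?_
    filter_upwards [hφ.memLp.coeFn_toLp] with x hx
    rw [hx]
  rw [e1, e2]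
  linarith

/-- Membership in `H10` supplies some partner in the closure; uniqueness of the weak derivative
forces it to be g. -/
theorem mem_closure_of_mem_H10 {f g : L2half} (hf : f ∈ H10) (h : HasWeakDeriv f g) :
    (f, g) ∈ testPairs.topologicalClosure := by
  obtain ⟨⟨f', g'⟩, hx, rfl⟩ := hf
  have := (hasWeakDeriv_of_mem_closure hx).unique h
  rw [← this]
  exact hx

/-- For `f ∈ H² ∩ H¹₀`, `‖f'‖² ≤ ‖f‖ ‖f''‖`. -/
theorem norm_weakDeriv_sq_le {f g h : L2half} (hf : f ∈ H10) (h1 : HasWeakDeriv f g)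
    (h2 : HasWeakDeriv g h) : ‖g‖ ^ 2 ≤ ‖f‖ * ‖h‖ := by
  have := inner_add_inner_eq_zero_of_mem_closure (mem_closure_of_mem_H10 hf h1) h2
  rw [real_inner_self_eq_norm_sq] at this
  have h3 := neg_le_of_abs_le (abs_real_inner_le_norm f h)
  linarith

/-- A bump centred at 0 serves as a probe: integration by parts against it detects the boundary
value at 0. -/
theorem exists_hasWeakDeriv_isPrim_one : ∃ (q p : L2half) (Q : ℝ → ℝ), HasWeakDeriv q p ∧
    q =ᵐ[halfLine] Q ∧ IsPrim Q p ∧ Q 0 = 1 := by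
  let b : ContDiffBump (0 : ℝ) := ⟨1 / 2, 1, by norm_num, by norm_num⟩
  have hb : ContDiff ℝ ∞ b := b.contDiff
  have h1 : MemLp b 2 halfLine := (b.continuous.memLp_of_hasCompactSupport b.hasCompactSupport).restrict _
  have h2 : MemLp (deriv b) 2 halfLine :=
    (((contDiff_infty_iff_deriv.mp hb).2.continuous).memLp_of_hasCompactSupport
      b.hasCompactSupport.deriv).restrict _
  have h3 : IsPrim b (h2.toLp (deriv b)) :=
    (IsPrim.of_contDiff (hb.of_le (by simp))).congr_deriv h2.coeFn_toLp.symm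
  refine ⟨h1.toLp b, h2.toLp _, b, .of_isPrim h1.coeFn_toLp h3, h1.coeFn_toLp, h3, ?_⟩
  exact b.one_of_mem_closedBall (by simp [b.rIn_pos.le])

/-- The boundary term against the probe Q with Q(0) = 1 is -F(0), while for limits of test pairs it
is zero. -/
theorem isPrim_zero_eq_zero_of_mem_H10 {f g : L2half} {F : ℝ → ℝ} (hf : f ∈ H10)
    (hfF : f =ᵐ[halfLine] F) (hF : IsPrim F g) : F 0 = 0 := by
  obtain ⟨q, p, Q, hqp, hqQ, hQ, hQ0⟩ := exists_hasWeakDeriv_isPrim_one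
  have h1 := inner_add_inner_eq_zero_of_mem_closure
    (mem_closure_of_mem_H10 hf (.of_isPrim hfF hF)) hqp
  have h2 := inner_add_inner_eq_neg hfF hF hqQ hQ
  rw [h1, hQ0] at h2
  linarith

/-- Duality: a continuous functional vanishing on the test pairs is represented by a pair (p, q),
and its vanishing says precisely that q' = p weakly. Integration by parts then evaluates it at (f,
g) as -F(0)Q(0) = 0, so Hahn-Banach leaves no room for (f, g) outside the closure. -/
theorem mem_H10_of_isPrim {f g : L2half} {F : ℝ → ℝ} (hfF : f =ᵐ[halfLine] F) (hF : IsPrim F g)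
    (h0 : F 0 = 0) : f ∈ H10 := by
  refine ⟨(f, g), ?_, rfl⟩
  by_contra hn
  obtain ⟨l, hl1, hl2⟩ : ∃ l : StrongDual ℝ (L2half × L2half), l (f, g) ≠ 0 ∧
      ∀ x ∈ testPairs, l x = 0 := by
    obtain ⟨l, u, hu, hl⟩ := geometric_hahn_banach_closed_point
      (testPairs.topologicalClosure.convex) testPairs.isClosed_topologicalClosure hn
    have hu0 : 0 < u := by simpa using hu 0 (zero_mem _)
    refine ⟨l, (hu0.trans hl).ne', fun x hx => ?_⟩
    by_contra hx0
    -- A functional bounded above by u on a subspace must vanish there: otherwise this rescaling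
    -- attains the value u, which the strict bound excludes.
    have h1 := hu ((u / l x) • x) (Submodule.le_topologicalClosure _ (testPairs.smul_mem _ hx))
    rw [map_smul, smul_eq_mul, div_mul_cancel₀ _ hx0] at h1
    exact lt_irrefl _ h1
  let q : L2half := (InnerProductSpace.toDual ℝ L2half).symm (l.comp (.inr ℝ L2half L2half))
  let p : L2half := (InnerProductSpace.toDual ℝ L2half).symm (l.comp (.inl ℝ L2half L2half))
  have hl : ∀ x : L2half × L2half, l x = inner ℝ x.2 q + inner ℝ x.1 p := by
    intro x
    rw [real_inner_comm, real_inner_comm p x.1, InnerProductSpace.toDual_symm_apply,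
      InnerProductSpace.toDual_symm_apply]
    simp only [ContinuousLinearMap.comp_apply, ContinuousLinearMap.inl_apply,
      ContinuousLinearMap.inr_apply]
    rw [← map_add]
    simp
  have hqp : HasWeakDeriv q p := by
    intro φ hφ
    have h1 := hl2 _ (exists_toLp_testFun hφ)
    rw [hl, inner_L2half, inner_L2half] at h1
    have e1 : ∫ x, q x * deriv φ x ∂halfLine =
        ∫ x, hφ.deriv.memLp.toLp (deriv φ) x * q x ∂halfLine := by
      refine integral_congr_ae ?_
      filter_upwards [hφ.deriv.memLp.coeFn_toLp] with x hx
      rw [hx, mul_comm]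
    have e2 : ∫ x, p x * φ x ∂halfLine = ∫ x, hφ.memLp.toLp φ x * p x ∂halfLine := by
      refine integral_congr_ae ?_
      filter_upwards [hφ.memLp.coeFn_toLp] with x hx
      rw [hx, mul_comm]
    rw [e1, e2]
    linarith
  obtain ⟨Q, -, hqQ, hQ⟩ := hqp.exists_isPrim
  refine hl1 ?_
  rw [hl, inner_add_inner_eq_neg hfF hF hqQ hQ, h0, zero_mul, neg_zero]

/-- An interval of length one is a probability space, so the L¹ norm on it is at most the L² norm.
-/
theorem setIntegral_abs_le_norm (k : L2half) {a : ℝ} (ha : 0 ≤ a) :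
    IntegrableOn k (Ioc a (a + 1)) ∧ ∫ x in Ioc a (a + 1), |k x| ≤ ‖k‖ := by
  have hp : IsProbabilityMeasure (volume.restrict (Ioc a (a + 1))) := ⟨by simp⟩
  have hle : volume.restrict (Ioc a (a + 1)) ≤ halfLine :=
    Measure.restrict_mono (fun x hx => ha.trans_lt hx.1) le_rfl
  have hk : MemLp k 2 (volume.restrict (Ioc a (a + 1))) := (Lp.memLp k).mono_measure hle
  have hk1 : IntegrableOn k (Ioc a (a + 1)) := hk.integrable (by norm_num)
  refine ⟨hk1, ?_⟩
  have h1 : ∫ x in Ioc a (a + 1), |k x| =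
      (eLpNorm k 1 (volume.restrict (Ioc a (a + 1)))).toReal := by
    rw [eLpNorm_one_eq_lintegral_enorm, ← integral_norm_eq_lintegral_enorm hk.1]
    simp only [Real.norm_eq_abs]
  rw [h1, Lp.norm_def]
  refine ENNReal.toReal_mono (Lp.eLpNorm_ne_top k) ?_
  exact (eLpNorm_le_eLpNorm_of_exponent_le (by norm_num) hk.1).trans (eLpNorm_mono_measure _ hle)

/-- The Sobolev inequality `‖f‖_∞ ≤ ‖f‖ + ‖f'‖` on the half-line. -/
theorem HasWeakDeriv.ae_abs_le {f g : L2half} (h : HasWeakDeriv f g) :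
    ∀ᵐ x ∂halfLine, |f x| ≤ ‖f‖ + ‖g‖ := by
  obtain ⟨F, hFc, hfF, hF⟩ := h.exists_isPrim
  filter_upwards [hfF, ae_restrict_mem measurableSet_Ioi] with x hx hx0
  rw [hx]
  have hx0' : (0 : ℝ) ≤ x := le_of_lt hx0
  obtain ⟨hf1, hf2⟩ := setIntegral_abs_le_norm f hx0'
  obtain ⟨hg1, hg2⟩ := setIntegral_abs_le_norm g hx0'
  have hfF' : ∀ᵐ s ∂volume.restrict (Ioc x (x + 1)), f s = F s :=
    ae_restrict_of_ae_restrict_of_subset (fun s hs => hx0'.trans_lt hs.1) hfF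
  -- F(x) differs from F(s) by an integral of g over part of the unit interval; averaging over s
  -- then replaces |f(s)| by at most ‖f‖.
  have key : ∀ᵐ s ∂volume.restrict (Ioc x (x + 1)), |F x| ≤ |f s| + ‖g‖ := by
    filter_upwards [hfF', ae_restrict_mem measurableSet_Ioc] with s hs hsI
    rw [hs]
    have h1 := hF.integral_eq' hx0' (hx0'.trans hsI.1.le)
    have h2 : |∫ t in x..s, g t| ≤ ‖g‖ := by
      rw [intervalIntegral.integral_of_le hsI.1.le, ← Real.norm_eq_abs]
      refine (norm_integral_le_integral_norm _).trans (le_trans ?_ hg2)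
      exact setIntegral_mono_set hg1.norm (.of_forall fun t => norm_nonneg _)
        (LE.le.eventuallyLE (Ioc_subset_Ioc_right hsI.2))
    rw [h1] at h2
    have h3 := abs_sub_abs_le_abs_sub (F x) (F s)
    rw [abs_sub_comm] at h3
    linarith
  have hm := integral_mono_ae (integrable_const _) (hf1.abs.add (integrable_const ‖g‖)) key
  simp only [Pi.add_apply] at hm
  rw [integral_add hf1.abs (integrable_const _)] at hm
  simp only [integral_const, measureReal_restrict_apply_univ, Real.volume_real_Ioc, smul_eq_mul,
    add_sub_cancel_left, max_eq_left zero_le_one, one_mul] at hm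
  linarith

/-! ### Maps into `L^p(ℝ₊)` that are Lipschitz on bounded sets -/

/-- `m` maps bounded sets to bounded sets of `L^p(ℝ₊; W)`, and is Lipschitz on bounded sets. -/
structure LocLip {X W : Type*} [NormedAddCommGroup X] [NormedAddCommGroup W] (p : ℝ≥0∞)
    (m : X → ℝ → W) : Prop where
  meas : ∀ u, AEStronglyMeasurable (m u) halfLine
  bound : ∀ R : ℝ, ∃ K : ℝ≥0, (∀ u, ‖u‖ ≤ R → eLpNorm (m u) p halfLine ≤ K) ∧
    ∀ u v, ‖u‖ ≤ R → ‖v‖ ≤ R → eLpNorm (m u - m v) p halfLine ≤ K * ‖u - v‖ₑ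

namespace LocLip

variable {X W : Type*} [NormedAddCommGroup X] [NormedAddCommGroup W] {p : ℝ≥0∞}

theorem memLp {m : X → ℝ → W} (hm : LocLip p m) (u : X) : MemLp (m u) p halfLine := by
  obtain ⟨K, hK, -⟩ := hm.bound ‖u‖
  exact ⟨hm.meas u, (hK u le_rfl).trans_lt ENNReal.coe_lt_top⟩

theorem congr {m m' : X → ℝ → W} (hm : LocLip p m) (h : ∀ u, m u =ᵐ[halfLine] m' u) :
    LocLip p m' where
  meas u := (hm.meas u).congr (h u)
  bound R := by
    obtain ⟨K, h1, h2⟩ := hm.bound R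
    refine ⟨K, fun u hu => ?_, fun u v hu hv => ?_⟩
    · rw [← eLpNorm_congr_ae (h u)]
      exact h1 u hu
    · rw [← eLpNorm_congr_ae ((h u).sub (h v))]
      exact h2 u v hu hv

theorem add [hp : Fact (1 ≤ p)] {m n : X → ℝ → W} (hm : LocLip p m) (hn : LocLip p n) :
    LocLip p (fun u x => m u x + n u x) where
  meas u := (hm.meas u).add (hn.meas u)
  bound R := by
    obtain ⟨K, h1, h2⟩ := hm.bound R
    obtain ⟨L, k1, k2⟩ := hn.bound R
    refine ⟨K + L, fun u hu => ?_, fun u v hu hv => ?_⟩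
    · rw [ENNReal.coe_add]
      exact (eLpNorm_add_le (hm.meas u) (hn.meas u) hp.out).trans
        (add_le_add (h1 u hu) (k1 u hu))
    · rw [ENNReal.coe_add, add_mul]
      have e : ((fun x => m u x + n u x) - fun x => m v x + n v x) = (m u - m v) + (n u - n v) := by
        funext x
        simp only [Pi.sub_apply, Pi.add_apply]
        abel
      rw [e]
      exact (eLpNorm_add_le ((hm.meas u).sub (hm.meas v)) ((hn.meas u).sub (hn.meas v))
        hp.out).trans (add_le_add (h2 u v hu hv) (k2 u v hu hv))

theorem smul [NormedSpace ℝ W] {q r : ℝ≥0∞} [ENNReal.HolderTriple p q r] [hr : Fact (1 ≤ r)]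
    {m : X → ℝ → ℝ} {n : X → ℝ → W} (hm : LocLip p m) (hn : LocLip q n) :
    LocLip r (fun u x => m u x • n u x) where
  meas u := (hm.meas u).smul (hn.meas u)
  bound R := by
    obtain ⟨K, h1, h2⟩ := hm.bound R
    obtain ⟨L, k1, k2⟩ := hn.bound R
    -- The factor 2 counts the two terms of m(u)(n(u) - n(v)) + (m(u) - m(v)) n(v).
    refine ⟨2 * (K * L), fun u hu => ?_, fun u v hu hv => ?_⟩
    · refine (eLpNorm_smul_le_mul_eLpNorm (hn.meas u) (hm.meas u) (p := p) (q := q)).trans ?_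
      refine (mul_le_mul' (h1 u hu) (k1 u hu)).trans ?_
      rw [← ENNReal.coe_mul, ENNReal.coe_le_coe]
      exact le_mul_of_one_le_left zero_le (by norm_num)
    · have e : ((fun x => m u x • n u x) - fun x => m v x • n v x) =
          m u • (n u - n v) + (m u - m v) • n v := by
        funext x
        simp only [Pi.sub_apply, Pi.add_apply, Pi.smul_apply', smul_sub, sub_smul]
        abel
      rw [e]
      refine (eLpNorm_add_le ((hm.meas u).smul ((hn.meas u).sub (hn.meas v)))
        (((hm.meas u).sub (hm.meas v)).smul (hn.meas v)) hr.out).trans ?_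
      refine (add_le_add
        ((eLpNorm_smul_le_mul_eLpNorm ((hn.meas u).sub (hn.meas v)) (hm.meas u)
          (p := p) (q := q)).trans (mul_le_mul' (h1 u hu) (k2 u v hu hv)))
        ((eLpNorm_smul_le_mul_eLpNorm (hn.meas v) ((hm.meas u).sub (hm.meas v))
          (p := p) (q := q)).trans (mul_le_mul' (h2 u v hu hv) (k1 v hv)))).trans ?_
      push_cast
      apply le_of_eq
      ring

theorem const_smul [NormedSpace ℝ W] (c : ℝ) {m : X → ℝ → W} (hm : LocLip p m) :
    LocLip p (fun u x => c • m u x) where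
  meas u := (hm.meas u).const_smul c
  bound R := by
    obtain ⟨K, h1, h2⟩ := hm.bound R
    refine ⟨‖c‖₊ * K, fun u hu => ?_, fun u v hu hv => ?_⟩
    · refine (eLpNorm_const_smul_le (c := c) (f := m u)).trans ?_
      rw [ENNReal.coe_mul]
      exact mul_le_mul_right (h1 u hu) _
    · have e : ((fun x => c • m u x) - fun x => c • m v x) = c • (m u - m v) := by
        funext x
        simp only [Pi.sub_apply, Pi.smul_apply, smul_sub]
      rw [e, ENNReal.coe_mul, mul_assoc]
      exact (eLpNorm_const_smul_le).trans (mul_le_mul_right (h2 u v hu hv) _)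

theorem of_linear [NormedSpace ℝ X] [NormedSpace ℝ W] {q : ℝ≥0∞} (T : X →ₗ[ℝ] Lp W q halfLine)
    (C : ℝ≥0) (h : ∀ u, eLpNorm (T u) p halfLine ≤ C * ‖u‖ₑ) : LocLip p (fun u x => T u x) where
  meas u := Lp.aestronglyMeasurable _
  bound R := by
    -- R serves the bound on the ball, 1 the Lipschitz estimate.
    refine ⟨C * max 1 R.toNNReal, fun u hu => (h u).trans ?_, fun u v hu hv => ?_⟩
    · rw [ENNReal.coe_mul]
      refine mul_le_mul_right ?_ _
      rw [enorm_eq_nnnorm, ENNReal.coe_le_coe]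
      exact (NNReal.le_toNNReal_of_coe_le hu).trans (le_max_right _ _)
    · have e : (fun x => T u x) - (fun x => T v x) =ᵐ[halfLine] T (u - v) := by
        rw [map_sub]
        exact (Lp.coeFn_sub _ _).symm
      rw [eLpNorm_congr_ae e]
      refine (h _).trans (mul_le_mul_left ?_ _)
      rw [ENNReal.coe_le_coe]
      exact le_mul_of_one_le_right zero_le (le_max_left _ _)

end LocLip

/-! ### Superposition operators u ↦ τ(x, u(x)) on L^∞ and L². -/

/-- `τ` is continuous, and locally Lipschitz in the second variable uniformly in the first one. -/
structure IsLipCoeff (τ : ℝ → ℝ → ℝ) : Prop where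
  cont : Continuous (fun p : ℝ × ℝ => τ p.1 p.2)
  lip : ∀ r : ℝ, ∃ L : ℝ, ∀ x y z : ℝ, |y| ≤ r → |z| ≤ r → |τ x y - τ x z| ≤ L * |y - z|

/-- Coefficients that are bounded for bounded `y`. -/
structure IsBddCoeff (τ : ℝ → ℝ → ℝ) : Prop extends IsLipCoeff τ where
  growth : ∀ r : ℝ, ∃ B : ℝ, ∀ x y : ℝ, |y| ≤ r → |τ x y| ≤ B

/-- Coefficients bounded by `a(|x|) + B |y|` for bounded `y`, where `a ∈ L²(ℝ₊)`. -/
structure IsL2Coeff (τ : ℝ → ℝ → ℝ) : Prop extends IsLipCoeff τ where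
  growth : ∃ a : ℝ → ℝ, MemLp a 2 halfLine ∧
    ∀ r : ℝ, ∃ B : ℝ, ∀ x y : ℝ, |y| ≤ r → |τ x y| ≤ a |x| + B * |y|

section Composition

variable {X : Type*} [NormedAddCommGroup X] {f : X → ℝ → ℝ} {τ : ℝ → ℝ → ℝ}

theorem LocLip.exists_ae_abs_le (hf : LocLip ⊤ f) (R : ℝ) :
    ∃ r : ℝ, ∀ u, ‖u‖ ≤ R → ∀ᵐ x ∂halfLine, |f u x| ≤ r := by
  obtain ⟨K, h1, -⟩ := hf.bound R
  refine ⟨K, fun u hu => ?_⟩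
  have h := h1 u hu
  rw [eLpNorm_exponent_top] at h
  filter_upwards [ae_le_eLpNormEssSup (f := f u) (μ := halfLine)] with x hx
  have := hx.trans h
  rw [enorm_eq_nnnorm, ENNReal.coe_le_coe] at this
  exact_mod_cast this

theorem IsLipCoeff.aestronglyMeasurable (hτ : IsLipCoeff τ) {g : ℝ → ℝ}
    (hg : AEStronglyMeasurable g halfLine) :
    AEStronglyMeasurable (fun x => τ x (g x)) halfLine :=
  hτ.cont.comp_aestronglyMeasurable (aestronglyMeasurable_id.prodMk hg)

/-- The L^∞ bound on f(u) confines all arguments to one interval [-r, r], so a single Lipschitz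
constant of τ applies; the difference is then measured in any L^p in which f itself is Lipschitz. -/
theorem IsLipCoeff.eLpNorm_sub_le (hτ : IsLipCoeff τ) (hf : LocLip ⊤ f) {p : ℝ≥0∞}
    (hfp : LocLip p f) (R : ℝ) : ∃ K : ℝ≥0, ∀ u v, ‖u‖ ≤ R → ‖v‖ ≤ R →
      eLpNorm ((fun x => τ x (f u x)) - fun x => τ x (f v x)) p halfLine ≤ K * ‖u - v‖ₑ := by
  obtain ⟨r, hr⟩ := hf.exists_ae_abs_le R
  obtain ⟨L, hL⟩ := hτ.lip r
  obtain ⟨K, -, h2⟩ := hfp.bound R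
  refine ⟨L.toNNReal * K, fun u v hu hv => ?_⟩
  have h : ∀ᵐ x ∂halfLine, ‖((fun x => τ x (f u x)) - fun x => τ x (f v x)) x‖ ≤
      L.toNNReal * ‖(f u - f v) x‖ := by
    filter_upwards [hr u hu, hr v hv] with x h1 h2
    refine (hL x _ _ h1 h2).trans ?_
    exact mul_le_mul_of_nonneg_right (Real.le_coe_toNNReal L) (abs_nonneg _)
  refine (eLpNorm_le_nnreal_smul_eLpNorm_of_ae_le_mul h p).trans ?_
  rw [ENNReal.smul_def, smul_eq_mul, ENNReal.coe_mul, mul_assoc]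
  exact mul_le_mul_right (h2 u v hu hv) _

theorem IsBddCoeff.locLip (hτ : IsBddCoeff τ) (hf : LocLip ⊤ f) :
    LocLip ⊤ (fun u x => τ x (f u x)) where
  meas u := hτ.aestronglyMeasurable (hf.meas u)
  bound R := by
    obtain ⟨r, hr⟩ := hf.exists_ae_abs_le R
    obtain ⟨B, hB⟩ := hτ.growth r
    obtain ⟨K, hK⟩ := hτ.eLpNorm_sub_le hf hf R
    refine ⟨max B.toNNReal K, fun u hu => ?_, fun u v hu hv => (hK u v hu hv).trans ?_⟩
    · rw [eLpNorm_exponent_top]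
      refine eLpNormEssSup_le_of_ae_nnnorm_bound ?_
      filter_upwards [hr u hu] with x hx
      rw [← NNReal.coe_le_coe]
      refine (hB x _ hx).trans ((Real.le_coe_toNNReal B).trans ?_)
      exact_mod_cast le_max_left _ _
    · refine mul_le_mul_left ?_ _
      exact_mod_cast le_max_right _ _

theorem IsL2Coeff.locLip (hτ : IsL2Coeff τ) (hf : LocLip ⊤ f) (hf2 : LocLip 2 f) :
    LocLip 2 (fun u x => τ x (f u x)) where
  meas u := hτ.aestronglyMeasurable (hf.meas u)
  bound R := by
    obtain ⟨r, hr⟩ := hf.exists_ae_abs_le R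
    obtain ⟨a, ha, hg⟩ := hτ.growth
    obtain ⟨B, hB⟩ := hg r
    obtain ⟨K, hK⟩ := hτ.eLpNorm_sub_le hf hf2 R
    obtain ⟨M, hM, -⟩ := hf2.bound R
    refine ⟨max ((eLpNorm a 2 halfLine).toNNReal + ‖B‖₊ * M) K, fun u hu => ?_,
      fun u v hu hv => (hK u v hu hv).trans ?_⟩
    · have h : ∀ᵐ x ∂halfLine, ‖τ x (f u x)‖ ≤ ‖(a + B • fun x => ‖f u x‖) x‖ := by
        filter_upwards [hr u hu, ae_restrict_mem measurableSet_Ioi] with x hx hx0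
        have := hB x _ hx
        -- On the half-line a(|x|) is a(x), whose L² norm is finite.
        rw [show |x| = x from abs_of_pos hx0] at this
        exact this.trans (le_abs_self _)
      refine (eLpNorm_mono_ae h).trans ?_
      refine (eLpNorm_add_le ha.1 ((hf2.meas u).norm.const_smul B) (by norm_num)).trans ?_
      refine le_trans ?_ (ENNReal.coe_le_coe.mpr (le_max_left _ _))
      rw [ENNReal.coe_add, ENNReal.coe_toNNReal ha.2.ne, ENNReal.coe_mul]
      refine add_le_add_right ((eLpNorm_const_smul_le).trans ?_) _
      rw [eLpNorm_norm]
      exact mul_le_mul_right (hM u hu) _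
    · refine mul_le_mul_left ?_ _
      exact_mod_cast le_max_right _ _

end Composition

/-! ### Partial derivatives of functions of two variables -/

/-- The partial derivative in the first variable. -/
noncomputable def partialX (τ : ℝ → ℝ → ℝ) (x y : ℝ) : ℝ := deriv (fun x' => τ x' y) x

/-- The partial derivative in the second variable. -/
noncomputable def partialY (τ : ℝ → ℝ → ℝ) (x y : ℝ) : ℝ := deriv (τ x) y

section Partial

variable {τ : ℝ → ℝ → ℝ}

theorem partialX_eq_fderiv (hτ : Differentiable ℝ (fun p : ℝ × ℝ => τ p.1 p.2)) (p : ℝ × ℝ) :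
    partialX τ p.1 p.2 = fderiv ℝ (fun p : ℝ × ℝ => τ p.1 p.2) p (1, 0) := by
  have h1 : HasDerivAt (fun x' => ((x', p.2) : ℝ × ℝ)) (1, 0) p.1 :=
    (hasDerivAt_id p.1).prodMk (hasDerivAt_const p.1 p.2)
  exact ((hτ p).hasFDerivAt.comp_hasDerivAt p.1 h1).deriv

theorem partialY_eq_fderiv (hτ : Differentiable ℝ (fun p : ℝ × ℝ => τ p.1 p.2)) (p : ℝ × ℝ) :
    partialY τ p.1 p.2 = fderiv ℝ (fun p : ℝ × ℝ => τ p.1 p.2) p (0, 1) := by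
  have h1 : HasDerivAt (fun y' => ((p.1, y') : ℝ × ℝ)) (0, 1) p.2 :=
    (hasDerivAt_const p.2 p.1).prodMk (hasDerivAt_id p.2)
  exact ((hτ p).hasFDerivAt.comp_hasDerivAt p.2 h1).deriv

theorem contDiff_partialX {n : ℕ} (hτ : ContDiff ℝ (n + 1) (fun p : ℝ × ℝ => τ p.1 p.2)) :
    ContDiff ℝ n (fun p : ℝ × ℝ => partialX τ p.1 p.2) := by
  simp_rw [partialX_eq_fderiv (hτ.differentiable (by simp))]
  exact (hτ.fderiv_right le_rfl).clm_apply contDiff_const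

theorem contDiff_partialY {n : ℕ} (hτ : ContDiff ℝ (n + 1) (fun p : ℝ × ℝ => τ p.1 p.2)) :
    ContDiff ℝ n (fun p : ℝ × ℝ => partialY τ p.1 p.2) := by
  simp_rw [partialY_eq_fderiv (hτ.differentiable (by simp))]
  exact (hτ.fderiv_right le_rfl).clm_apply contDiff_const

/-- Needed because `partialDeriv` differentiates in y before x, while the chain rule applied to ∂ₓσ
produces the opposite order. -/
theorem partialY_partialX (hτ : ContDiff ℝ 2 (fun p : ℝ × ℝ => τ p.1 p.2)) :
    partialY (partialX τ) = partialX (partialY τ) := by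
  have hd := hτ.differentiable (by simp)
  have hX := contDiff_partialX (n := 1) (by exact_mod_cast hτ)
  have hY := contDiff_partialY (n := 1) (by exact_mod_cast hτ)
  have hf : Differentiable ℝ (fderiv ℝ (fun p : ℝ × ℝ => τ p.1 p.2)) :=
    (hτ.fderiv_right (m := 1) (by norm_num)).differentiable (by simp)
  funext x y
  rw [partialY_eq_fderiv (hX.differentiable (by simp)) (x, y),
    partialX_eq_fderiv (hY.differentiable (by simp)) (x, y)]
  simp_rw [partialX_eq_fderiv hd, partialY_eq_fderiv hd]
  rw [fderiv_clm_apply (hf _) (differentiableAt_const _),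
    fderiv_clm_apply (hf _) (differentiableAt_const _)]
  simp only [fderiv_fun_const, Pi.zero_apply, ContinuousLinearMap.comp_zero, zero_add,
    ContinuousLinearMap.flip_apply]
  exact (hτ.contDiffAt.isSymmSndFDerivAt (by simp)) _ _

/-- The chain rule along a curve `x ↦ (x, F x)`. -/
theorem hasDerivAt_comp_graph (hτ : Differentiable ℝ (fun p : ℝ × ℝ => τ p.1 p.2)) {F : ℝ → ℝ}
    {F' x : ℝ} (hF : HasDerivAt F F' x) : HasDerivAt (fun x => τ x (F x))
      (partialX τ x (F x) + partialY τ x (F x) * F') x := by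
  have h := (hτ (x, F x)).hasFDerivAt.comp_hasDerivAt x ((hasDerivAt_id x).prodMk hF)
  refine h.congr_deriv ?_
  rw [partialX_eq_fderiv hτ (x, F x), partialY_eq_fderiv hτ (x, F x)]
  have e : ((1, F') : ℝ × ℝ) = (1, 0) + F' • (0, 1) := by simp
  rw [e, map_add, map_smul, smul_eq_mul, mul_comm F']

theorem partialX_reflect (τ : ℝ → ℝ → ℝ) :
    partialX (fun x y => τ (-x) y) = fun x y => -partialX τ (-x) y := by
  funext x y
  exact deriv_comp_neg (fun x' => τ x' y) x

theorem IsLipCoeff.reflect (h : IsLipCoeff τ) (ε : ℝ) (hε : |ε| = 1) :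
    IsLipCoeff (fun x y => ε * τ (-x) y) where
  cont := continuous_const.mul
    (h.cont.comp ((continuous_fst.neg).prodMk continuous_snd))
  lip r := by
    obtain ⟨L, hL⟩ := h.lip r
    refine ⟨L, fun x y z hy hz => ?_⟩
    rw [← mul_sub, abs_mul, hε, one_mul]
    exact hL (-x) y z hy hz

theorem IsBddCoeff.reflect (h : IsBddCoeff τ) (ε : ℝ) (hε : |ε| = 1) :
    IsBddCoeff (fun x y => ε * τ (-x) y) where
  toIsLipCoeff := h.toIsLipCoeff.reflect ε hε
  growth r := by
    obtain ⟨B, hB⟩ := h.growth r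
    refine ⟨B, fun x y hy => ?_⟩
    rw [abs_mul, hε, one_mul]
    exact hB (-x) y hy

theorem IsL2Coeff.reflect (h : IsL2Coeff τ) (ε : ℝ) (hε : |ε| = 1) :
    IsL2Coeff (fun x y => ε * τ (-x) y) where
  toIsLipCoeff := h.toIsLipCoeff.reflect ε hε
  growth := by
    obtain ⟨a, ha, hg⟩ := h.growth
    refine ⟨a, ha, fun r => ?_⟩
    obtain ⟨B, hB⟩ := hg r
    refine ⟨B, fun x y hy => ?_⟩
    rw [abs_mul, hε, one_mul, ← abs_neg x]
    exact hB (-x) y hy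

end Partial

/-! ### From the growth assumptions on σ to pointwise bounds. -/

/-- The consequences of `SigmaAssumption` for the partial derivatives of `σ`. -/
structure IsSigmaCoeff (σ : ℝ → ℝ → ℝ) : Prop where
  contDiff : ContDiff ℝ 2 (fun p : ℝ × ℝ => σ p.1 p.2)
  coeff : IsL2Coeff σ
  coeffX : IsL2Coeff (partialX σ)
  coeffXX : IsL2Coeff (partialX (partialX σ))
  coeffY : IsBddCoeff (partialY σ)
  coeffXY : IsBddCoeff (partialX (partialY σ))
  coeffYY : IsBddCoeff (partialY (partialY σ))
  boundary : σ 0 0 = 0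

theorem partialY_const_mul_reflect (τ : ℝ → ℝ → ℝ) (ε : ℝ) :
    partialY (fun x y => ε * τ (-x) y) = fun x y => ε * partialY τ (-x) y := by
  funext x y
  exact deriv_const_mul_field ε

theorem partialX_const_mul_reflect (τ : ℝ → ℝ → ℝ) (ε : ℝ) :
    partialX (fun x y => ε * τ (-x) y) = fun x y => -ε * partialX τ (-x) y := by
  funext x y
  have h : partialX (fun x y => ε * τ (-x) y) x y =
      ε * partialX (fun x y => τ (-x) y) x y := deriv_const_mul_field ε
  rw [h, partialX_reflect]
  ring

/-- Reduces the second component to the first. Each x-derivative only contributes a sign, which the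
absolute values in the assumptions ignore. -/
theorem IsSigmaCoeff.reflect {σ : ℝ → ℝ → ℝ} (h : IsSigmaCoeff σ) :
    IsSigmaCoeff (fun x y => σ (-x) y) := by
  -- The shape ε · σ(-x, y) is stable under both partial derivatives, so the rewriting can be
  -- iterated.
  have e : (fun x y => σ (-x) y) = fun x y => 1 * σ (-x) y := by
    funext x y
    rw [one_mul]
  have h1 : |(1 : ℝ)| = 1 := abs_one
  have h2 : |(-1 : ℝ)| = 1 := by simp
  have h3 : |(- -1 : ℝ)| = 1 := by simp
  rw [e]
  constructor
  · exact contDiff_const.mul (h.contDiff.comp ((contDiff_fst.neg).prodMk contDiff_snd))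
  · exact h.coeff.reflect 1 h1
  · rw [partialX_const_mul_reflect]
    exact h.coeffX.reflect _ h2
  · rw [partialX_const_mul_reflect, partialX_const_mul_reflect]
    exact h.coeffXX.reflect _ h3
  · rw [partialY_const_mul_reflect]
    exact h.coeffY.reflect _ h1
  · rw [partialY_const_mul_reflect, partialX_const_mul_reflect]
    exact h.coeffXY.reflect _ h2
  · rw [partialY_const_mul_reflect, partialY_const_mul_reflect]
    exact h.coeffYY.reflect _ h1
  · simp [h.boundary]

/-- The set where the inequality fails is open in the interval and null, hence empty. -/
theorem Continuous.le_of_ae_restrict_le {f g : ℝ → ℝ} {a b : ℝ} (hf : Continuous f) (hg : Continuous g)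
    (h : ∀ᵐ y ∂volume.restrict (Ioo a b), f y ≤ g y) {y : ℝ} (hy : y ∈ Ioo a b) : f y ≤ g y := by
  by_contra hn
  have ho : IsOpen (Ioo a b ∩ {y | g y < f y}) := isOpen_Ioo.inter (isOpen_lt hg hf)
  have h0 : volume (Ioo a b ∩ {y | g y < f y}) = 0 := by
    rw [ae_restrict_iff' measurableSet_Ioo, ae_iff] at h
    refine measure_mono_null ?_ h
    rintro z ⟨h1, h2⟩ h3
    exact not_lt.mpr (h3 h1) h2
  have he := (ho.measure_eq_zero_iff (μ := volume)).mp h0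
  exact notMem_empty y (he ▸ ⟨hy, not_le.mp hn⟩)

/-- b is only essentially bounded on compact sets. The radius r + 1 gives an open interval
containing [-r, r], on which continuity of τ later upgrades the estimate to every y. -/
theorem exists_ae_le_of_memLp_top {b : ℝ → ℝ}
    (hb : ∀ K : Set ℝ, IsCompact K → MemLp b ⊤ (volume.restrict K)) (r : ℝ) :
    ∃ B : ℝ, ∀ᵐ y ∂volume.restrict (Ioo (-(r + 1)) (r + 1)), b y ≤ B := by
  have h := hb (Icc (-(r + 1)) (r + 1)) isCompact_Icc
  refine ⟨(eLpNorm b ⊤ (volume.restrict (Icc (-(r + 1)) (r + 1)))).toReal, ?_⟩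
  refine ae_restrict_of_ae_restrict_of_subset Ioo_subset_Icc_self ?_
  have hfin := h.2.ne
  rw [eLpNorm_exponent_top] at hfin ⊢
  filter_upwards [ae_le_eLpNormEssSup (f := b)
    (μ := volume.restrict (Icc (-(r + 1)) (r + 1)))] with y hy
  have := ENNReal.toReal_mono hfin hy
  rw [toReal_enorm] at this
  exact (le_abs_self _).trans this

theorem isL2Coeff_of_growth {τ : ℝ → ℝ → ℝ} {a b : ℝ → ℝ} (h : IsLipCoeff τ)
    (ha : MemLp a 2 halfLine)
    (hb : ∀ K : Set ℝ, IsCompact K → MemLp b ⊤ (volume.restrict K))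
    (hg : ∀ x y, |τ x y| ≤ a |x| + b y * |y|) : IsL2Coeff τ where
  toIsLipCoeff := h
  growth := by
    refine ⟨a, ha, fun r => ?_⟩
    obtain ⟨B, hB⟩ := exists_ae_le_of_memLp_top hb r
    refine ⟨B, fun x y hy => ?_⟩
    refine Continuous.le_of_ae_restrict_le (f := fun y => |τ x y|) (g := fun y => a |x| + B * |y|)
      (a := -(r + 1)) (b := r + 1) ?_ (by fun_prop) ?_ ?_
    · exact (h.cont.comp (Continuous.prodMk_right x)).abs
    · filter_upwards [hB] with y hy
      exact (hg x y).trans (add_le_add_right (mul_le_mul_of_nonneg_right hy (abs_nonneg y)) _)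
    · have := abs_le.mp hy
      constructor <;> linarith

theorem isBddCoeff_of_growth {τ : ℝ → ℝ → ℝ} {b : ℝ → ℝ} (h : IsLipCoeff τ)
    (hb : ∀ K : Set ℝ, IsCompact K → MemLp b ⊤ (volume.restrict K))
    (hg : ∀ x y, |τ x y| ≤ b y) : IsBddCoeff τ where
  toIsLipCoeff := h
  growth r := by
    obtain ⟨B, hB⟩ := exists_ae_le_of_memLp_top hb r
    refine ⟨B, fun x y hy => ?_⟩
    refine Continuous.le_of_ae_restrict_le (f := fun y => |τ x y|) (g := fun _ => B)
      (a := -(r + 1)) (b := r + 1) ?_ (by fun_prop) ?_ ?_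
    · exact (h.cont.comp (Continuous.prodMk_right x)).abs
    · filter_upwards [hB] with y hy
      exact (hg x y).trans hy
    · have := abs_le.mp hy
      constructor <;> linarith

theorem SigmaAssumption.isSigmaCoeff {σ : ℝ → ℝ → ℝ} (h : SigmaAssumption σ) :
    IsSigmaCoeff σ := by
  have hc := h.contDiff
  have hX := contDiff_partialX (n := 1) (by exact_mod_cast hc)
  have hY := contDiff_partialY (n := 1) (by exact_mod_cast hc)
  have hXX := contDiff_partialX (n := 0) (by exact_mod_cast hX)
  have hXY := contDiff_partialX (n := 0) (by exact_mod_cast hY)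
  have hYY := contDiff_partialY (n := 0) (by exact_mod_cast hY)
  have e00 : partialDeriv 0 0 σ = σ := by
    funext x y
    simp [partialDeriv]
  have e10 : partialDeriv 1 0 σ = partialX σ := by
    funext x y
    simp [partialDeriv, partialX]
  have e01 : partialDeriv 0 1 σ = partialY σ := by
    funext x y
    simp [partialDeriv, partialY]
  have e11 : partialDeriv 1 1 σ = partialX (partialY σ) := by
    funext x y
    simp [partialDeriv, partialX, partialY]
  have e20 : partialDeriv 2 0 σ = partialX (partialX σ) := by
    funext x y
    simp only [partialDeriv, partialX, iteratedDeriv_succ, iteratedDeriv_zero]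
  have e02 : partialDeriv 0 2 σ = partialY (partialY σ) := by
    funext x y
    simp only [partialDeriv, partialY, iteratedDeriv_succ, iteratedDeriv_zero]
    rfl
  have hL2 : ∀ i τ, i + 0 ≤ 2 → partialDeriv i 0 σ = τ →
      Continuous (fun p : ℝ × ℝ => τ p.1 p.2) → IsL2Coeff τ := by
    rintro i τ hi rfl hτ
    obtain ⟨a, b, ha, -, hb, hg⟩ := h.growth i 0 hi
    exact isL2Coeff_of_growth ⟨hτ, h.lipschitz i 0 hi⟩ ha hb (by simpa using hg)
  have hB : ∀ i j τ, i + (j + 1) ≤ 2 → partialDeriv i (j + 1) σ = τ →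
      Continuous (fun p : ℝ × ℝ => τ p.1 p.2) → IsBddCoeff τ := by
    rintro i j τ hi rfl hτ
    obtain ⟨a, b, -, -, hb, hg⟩ := h.growth i (j + 1) hi
    exact isBddCoeff_of_growth ⟨hτ, h.lipschitz i (j + 1) hi⟩ hb (by simpa using hg)
  exact ⟨hc, hL2 0 _ (by norm_num) e00 hc.continuous, hL2 1 _ (by norm_num) e10 hX.continuous,
    hL2 2 _ (by norm_num) e20 hXX.continuous, hB 0 0 _ (by norm_num) e01 hY.continuous,
    hB 1 0 _ (by norm_num) e11 hXY.continuous, hB 0 1 _ (by norm_num) e02 hYY.continuous,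
    h.boundary⟩

/-! ### The integral kernel as a curve in `L²(ℝ)` -/

/-- The mean value inequality for x ↦ g(x) - c x. -/
theorem abs_sub_sub_mul_le {g g' : ℝ → ℝ} (hg : ∀ x, HasDerivAt g (g' x) x) {a b c C : ℝ}
    (hab : a ≤ b) (hC : ∀ x ∈ Icc a b, |g' x - c| ≤ C) : |g b - g a - (b - a) * c| ≤ C * (b - a) := by
  have h := (convex_Icc a b).norm_image_sub_le_of_norm_hasDerivWithin_le
    (f := fun x => g x - x * c) (f' := fun x => g' x - c) (C := C)
    (fun x _ =>
      (((hg x).fun_sub ((hasDerivAt_id' x).mul_const c)).congr_deriv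
        (by rw [one_mul])).hasDerivWithinAt)
    hC (left_mem_Icc.mpr hab) (right_mem_Icc.mpr hab)
  rw [Real.norm_eq_abs, Real.norm_eq_abs, abs_of_nonneg (sub_nonneg.mpr hab)] at h
  refine le_trans (le_of_eq ?_) h
  congr 1
  ring

/-- Convergence of the Riemann sums of a continuous derivative. -/
theorem tendsto_riemann_sum {g g' : ℝ → ℝ} (hg : ∀ x, HasDerivAt g (g' x) x)
    (hg' : Continuous g') :
    Filter.Tendsto (fun n : ℕ => ∑ k ∈ Finset.range n, (1 / n : ℝ) * g' (k / n)) Filter.atTop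
      (nhds (g 1 - g 0)) := by
  rw [Metric.tendsto_atTop]
  intro ε hε
  have hu := isCompact_Icc.uniformContinuousOn_of_continuous (hg'.continuousOn (s := Icc (0 : ℝ) 1))
  rw [Metric.uniformContinuousOn_iff] at hu
  obtain ⟨δ, hδ, hu⟩ := hu (ε / 2) (half_pos hε)
  obtain ⟨N, hN⟩ := exists_nat_gt (1 / δ)
  -- Starting at N + 1 makes n positive and the mesh 1/n smaller than δ.
  refine ⟨N + 1, fun n hn => ?_⟩
  have hn0 : (0 : ℝ) < n := by exact_mod_cast (Nat.succ_pos N).trans_le hn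
  have hnδ : 1 / (n : ℝ) < δ := by
    rw [div_lt_comm₀ hn0 hδ]
    exact hN.trans (by exact_mod_cast hn)
  have htel : g 1 - g 0 = ∑ k ∈ Finset.range n, (g ((k + 1 : ℕ) / n) - g (k / n)) := by
    rw [Finset.sum_range_sub (fun k : ℕ => g (k / n)), div_self hn0.ne', Nat.cast_zero, zero_div]
  rw [dist_comm, Real.dist_eq, htel, ← Finset.sum_sub_distrib]
  have hk : ∀ k ∈ Finset.range n,
      |g ((k + 1 : ℕ) / n) - g (k / n) - (1 / n : ℝ) * g' (k / n)| ≤ ε / 2 * (1 / n) := by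
    intro k hk
    have hkn : ((k : ℝ) + 1) ≤ n := by exact_mod_cast Finset.mem_range.mp hk
    have e : ((k + 1 : ℕ) / n : ℝ) - k / n = 1 / n := by
      push_cast
      ring
    have hle : (k / n : ℝ) ≤ (k + 1 : ℕ) / n := by
      rw [← sub_nonneg, e]
      positivity
    have h1 : ((k + 1 : ℕ) / n : ℝ) ≤ 1 := by
      rw [div_le_one hn0]
      exact_mod_cast hkn
    rw [← e]
    refine abs_sub_sub_mul_le hg hle fun x hx => ?_
    have h0 : (0 : ℝ) ≤ k / n := by positivity
    refine (hu x ⟨h0.trans hx.1, hx.2.trans h1⟩ (k / n) ⟨h0, hle.trans h1⟩ ?_).le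
    rw [Real.dist_eq, abs_of_nonneg (sub_nonneg.mpr hx.1)]
    linarith [hx.2]
  refine ((Finset.abs_sum_le_sum_abs _ _).trans (Finset.sum_le_sum hk)).trans_lt ?_
  rw [Finset.sum_const, Finset.card_range, nsmul_eq_mul]
  field_simp
  linarith

section Kernel

variable {F F' : ℝ → ℝ → ℝ}

/-- A mean value inequality in `L²(ℝ)` for a function differentiable in a parameter. -/
theorem eLpNorm_sub_sub_le (hF : ∀ x y, HasDerivAt (fun x => F x y) (F' x y) x)
    (hc : ∀ y, Continuous fun x => F' x y) (hm' : ∀ x, AEStronglyMeasurable (F' x) volume)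
    {v : ℝ → ℝ} (hv : AEStronglyMeasurable v volume) {a b : ℝ} {C : ℝ≥0∞}
    (hC : ∀ s ∈ Icc (0 : ℝ) 1, eLpNorm (F' (a + s * (b - a)) - v) 2 volume ≤ C) :
    eLpNorm (F b - F a - (b - a) • v) 2 volume ≤ ‖b - a‖ₑ * C := by
  -- For each y the increment is the limit of Riemann sums in the parameter. Every sum obeys the
  -- desired L² bound by the triangle inequality, and Fatou's lemma passes it to the limit; only
  -- measurability of the slices F'(x,·) is used, not joint measurability.
  let S : ℕ → ℝ → ℝ := fun n => ∑ k ∈ Finset.range n,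
    (1 / n * (b - a) : ℝ) • (F' (a + k / n * (b - a)) - v)
  have hS : ∀ n, AEStronglyMeasurable (S n) volume := fun n =>
    Finset.aestronglyMeasurable_sum _ fun k _ => ((hm' _).sub hv).const_smul _
  have hlim : ∀ y, Filter.Tendsto (fun n => S n y) Filter.atTop
      (nhds ((F b - F a - (b - a) • v) y)) := by
    intro y
    have h := tendsto_riemann_sum (g := fun s => F (a + s * (b - a)) y - s * ((b - a) * v y))
      (g' := fun s => (b - a) * (F' (a + s * (b - a)) y - v y)) (fun s => ?_) ?_
    · refine (h.congr fun n => ?_).trans (le_of_eq ?_)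
      · simp only [S, Finset.sum_apply, Pi.smul_apply, Pi.sub_apply, smul_eq_mul]
        refine Finset.sum_congr rfl fun k _ => ?_
        ring
      · congr 1
        simp only [Pi.sub_apply, Pi.smul_apply, smul_eq_mul, one_mul, zero_mul, add_zero, sub_zero,
          add_sub_cancel]
        ring
    · have h1 : HasDerivAt (fun s : ℝ => a + s * (b - a)) (b - a) s := by
        simpa using ((hasDerivAt_id s).mul_const (b - a)).const_add a
      have h2 := ((hF (a + s * (b - a)) y).comp s h1).sub
        ((hasDerivAt_id s).mul_const ((b - a) * v y))
      refine h2.congr_deriv ?_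
      ring
    · exact continuous_const.mul
        (((hc y).comp (by fun_prop : Continuous fun s : ℝ => a + s * (b - a))).sub continuous_const)
  have hbound : ∀ᶠ n in Filter.atTop, eLpNorm (S n) 2 volume ≤ ‖b - a‖ₑ * C := by
    filter_upwards [Filter.eventually_gt_atTop 0] with n hn
    have hn0 : (0 : ℝ) < n := by exact_mod_cast hn
    have hk : ∀ k ∈ Finset.range n, eLpNorm ((1 / n * (b - a) : ℝ) •
        (F' (a + k / n * (b - a)) - v)) 2 volume ≤ ‖(1 / n : ℝ)‖ₑ * (‖b - a‖ₑ * C) := by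
      intro k hk
      refine eLpNorm_const_smul_le.trans ?_
      rw [enorm_mul, mul_assoc]
      gcongr
      refine hC _ ⟨by positivity, ?_⟩
      rw [div_le_one hn0]
      exact_mod_cast (Finset.mem_range.mp hk).le
    refine (eLpNorm_sum_le (fun k _ => ((hm' _).sub hv).const_smul _) (by norm_num)).trans ?_
    refine (Finset.sum_le_sum hk).trans ?_
    rw [Finset.sum_const, Finset.card_range, nsmul_eq_mul, ← mul_assoc]
    have e : (n : ℝ≥0∞) * ‖(1 / n : ℝ)‖ₑ = 1 := by
      rw [Real.enorm_eq_ofReal (by positivity), ← ENNReal.ofReal_natCast,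
        ← ENNReal.ofReal_mul hn0.le, mul_one_div_cancel hn0.ne', ENNReal.ofReal_one]
    rw [e, one_mul]
  refine (Lp.eLpNorm_lim_le_liminf_eLpNorm hS _ (.of_forall hlim)).trans ?_
  exact Filter.liminf_le_of_frequently_le' hbound.frequently

variable {Z Z' : ℝ → NoiseSpace}

/-- Used twice: w = 0 yields a Lipschitz estimate for Z, and w = Z'(a) yields the remainder in the
derivative of Z at a. -/
theorem norm_sub_sub_smul_le (hF : ∀ x y, HasDerivAt (fun x => F x y) (F' x y) x)
    (hc : ∀ y, Continuous fun x => F' x y) (hZ : ∀ x, Z x =ᵐ[volume] F x)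
    (hZ' : ∀ x, Z' x =ᵐ[volume] F' x) (w : NoiseSpace) {a b : ℝ} {C : ℝ≥0}
    (hC : ∀ s ∈ Icc (0 : ℝ) 1, ‖Z' (a + s * (b - a)) - w‖ ≤ C) :
    ‖Z b - Z a - (b - a) • w‖ ≤ C * |b - a| := by
  have h := eLpNorm_sub_sub_le hF hc
    (fun x => (Lp.aestronglyMeasurable (Z' x)).congr (hZ' x))
    (Lp.aestronglyMeasurable w)
    (a := a) (b := b) (C := C) (fun s hs => ?_)
  · have e : F b - F a - (b - a) • (w : ℝ → ℝ) =ᵐ[volume] (Z b - Z a - (b - a) • w : NoiseSpace) := by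
      filter_upwards [hZ a, hZ b, Lp.coeFn_sub (Z b - Z a) ((b - a) • w), Lp.coeFn_sub (Z b) (Z a),
        Lp.coeFn_smul (b - a) w] with y h1 h2 h3 h4 h5
      simp only [h3, h4, h5, Pi.sub_apply, Pi.smul_apply, h1, h2]
    rw [eLpNorm_congr_ae e, ← Lp.enorm_def, ← ofReal_norm, ← ofReal_norm, ← ENNReal.ofReal_coe_nnreal,
      ← ENNReal.ofReal_mul (norm_nonneg _), ENNReal.ofReal_le_ofReal_iff (by positivity),
      mul_comm] at h
    exact h
  · have e : F' (a + s * (b - a)) - (w : ℝ → ℝ) =ᵐ[volume] (Z' (a + s * (b - a)) - w : NoiseSpace) := by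
      filter_upwards [hZ' (a + s * (b - a)), Lp.coeFn_sub (Z' (a + s * (b - a))) w] with y h1 h2
      rw [h2, Pi.sub_apply, Pi.sub_apply, h1]
    rw [eLpNorm_congr_ae e, ← Lp.enorm_def, enorm_eq_nnnorm, ENNReal.coe_le_coe]
    exact hC s hs

theorem lipschitzWith_of_norm_le (hF : ∀ x y, HasDerivAt (fun x => F x y) (F' x y) x)
    (hc : ∀ y, Continuous fun x => F' x y) (hZ : ∀ x, Z x =ᵐ[volume] F x)
    (hZ' : ∀ x, Z' x =ᵐ[volume] F' x) {M : ℝ≥0} (hM : ∀ x, ‖Z' x‖ ≤ M) : LipschitzWith M Z := by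
  refine LipschitzWith.of_dist_le_mul fun b a => ?_
  have h := norm_sub_sub_smul_le hF hc hZ hZ' 0 (a := a) (b := b) (C := M) (fun s _ => by
    rw [sub_zero]
    exact hM _)
  rwa [smul_zero, sub_zero, ← Real.dist_eq, ← dist_eq_norm] at h

/-- Since Z' is Lipschitz, the first-order remainder is at most M |b - a|². -/
theorem hasDerivAt_of_lipschitzWith (hF : ∀ x y, HasDerivAt (fun x => F x y) (F' x y) x)
    (hc : ∀ y, Continuous fun x => F' x y) (hZ : ∀ x, Z x =ᵐ[volume] F x)
    (hZ' : ∀ x, Z' x =ᵐ[volume] F' x) {M : ℝ≥0} (hM : LipschitzWith M Z') (a : ℝ) :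
    HasDerivAt Z (Z' a) a := by
  rw [hasDerivAt_iff_isLittleO]
  refine Asymptotics.IsBigO.trans_isLittleO ?_
    (Asymptotics.isLittleO_pow_sub_sub a (one_lt_two))
  refine Asymptotics.IsBigO.of_bound M (.of_forall fun b => ?_)
  have h := norm_sub_sub_smul_le hF hc hZ hZ' (Z' a) (a := a) (b := b)
    (C := M * ‖b - a‖₊) (fun s hs => ?_)
  · refine h.trans (le_of_eq ?_)
    simp [sq, mul_assoc]
  · rw [← dist_eq_norm]
    refine (hM.dist_le_mul _ _).trans ?_
    rw [NNReal.coe_mul, coe_nnnorm, dist_eq_norm, add_sub_cancel_left, norm_mul]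
    refine mul_le_mul_of_nonneg_left ?_ M.2
    refine mul_le_of_le_one_left (norm_nonneg _) ?_
    rw [Real.norm_eq_abs, abs_of_nonneg hs.1]
    exact hs.2

end Kernel

/-- A bounded Lipschitz map from `ℝ` to `L²(ℝ)`. -/
structure IsBddLip (M : ℝ≥0) (Z : ℝ → NoiseSpace) : Prop where
  bdd : ∀ x, ‖Z x‖ ≤ M
  lip : LipschitzWith M Z

theorem ZetaAssumption.exists_curve {ζ : ℝ → ℝ → ℝ} (h : ZetaAssumption ζ) :
    ∃ (Z Z' Z'' : ℝ → NoiseSpace) (M : ℝ≥0), (∀ x, Z x =ᵐ[volume] ζ x) ∧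
      (∀ x, HasDerivAt Z (Z' x) x) ∧ (∀ x, HasDerivAt Z' (Z'' x) x) ∧
      IsBddLip M Z ∧ IsBddLip M Z' ∧ IsBddLip M Z'' := by
  let D : ℕ → ℝ → ℝ → ℝ := fun i x y => iteratedDeriv i (fun x' => ζ x' y) x
  have hD : ∀ i < 3, ∀ x y, HasDerivAt (fun x => D i x y) (D (i + 1) x y) x := by
    intro i hi x y
    have h1 := (h.contDiff y).differentiable_iteratedDeriv i (by exact_mod_cast hi)
    have h2 := (h1 x).hasDerivAt
    rwa [← iteratedDeriv_succ] at h2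
  have hc : ∀ i ≤ 3, ∀ y, Continuous fun x => D i x y := fun i hi y =>
    (h.contDiff y).continuous_iteratedDeriv i (by exact_mod_cast hi)
  let Y : ∀ i, i ≤ 3 → ℝ → NoiseSpace := fun i hi x => (h.memLp i hi x).toLp
  have hY : ∀ i hi x, Y i hi x =ᵐ[volume] D i x := fun i hi x => (h.memLp i hi x).coeFn_toLp
  have hb : ∀ i hi, ∃ M : ℝ≥0, ∀ x, ‖Y i hi x‖ ≤ M := by
    intro i hi
    refine ⟨(⨆ x, eLpNorm (D i x) 2 volume).toNNReal, fun x => ?_⟩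
    rw [Lp.norm_toLp]
    exact ENNReal.toReal_mono (h.bounded i hi).ne (le_iSup (fun x => eLpNorm (D i x) 2 volume) x)
  obtain ⟨M0, h0⟩ := hb 0 (by norm_num)
  obtain ⟨M1, h1⟩ := hb 1 (by norm_num)
  obtain ⟨M2, h2⟩ := hb 2 (by norm_num)
  obtain ⟨M3, h3⟩ := hb 3 (by norm_num)
  let M := max (max M0 M1) (max M2 M3)
  have l0 : M0 ≤ M := (le_max_left _ _).trans (le_max_left _ _)
  have l1 : M1 ≤ M := (le_max_right _ _).trans (le_max_left _ _)
  have l2 : M2 ≤ M := (le_max_left _ _).trans (le_max_right _ _)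
  have l3 : M3 ≤ M := (le_max_right _ _).trans (le_max_right _ _)
  have k0 := lipschitzWith_of_norm_le (hD 0 (by norm_num)) (hc 1 (by norm_num))
    (hY 0 (by norm_num)) (hY 1 (by norm_num)) h1
  have k1 := lipschitzWith_of_norm_le (hD 1 (by norm_num)) (hc 2 (by norm_num))
    (hY 1 (by norm_num)) (hY 2 (by norm_num)) h2
  have k2 := lipschitzWith_of_norm_le (hD 2 (by norm_num)) (hc 3 (by norm_num))
    (hY 2 (by norm_num)) (hY 3 (by norm_num)) h3
  refine ⟨Y 0 (by norm_num), Y 1 (by norm_num), Y 2 (by norm_num), M, fun x => ?_, ?_, ?_,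
    ⟨fun x => (h0 x).trans (by exact_mod_cast l0), k0.weaken l1⟩,
    ⟨fun x => (h1 x).trans (by exact_mod_cast l1), k1.weaken l2⟩,
    ⟨fun x => (h2 x).trans (by exact_mod_cast l2), k2.weaken l3⟩⟩
  · refine (hY 0 (by norm_num) x).trans (.of_eq ?_)
    funext y
    simp [D]
  · exact hasDerivAt_of_lipschitzWith (hD 0 (by norm_num)) (hc 1 (by norm_num))
      (hY 0 (by norm_num)) (hY 1 (by norm_num)) k1
  · exact hasDerivAt_of_lipschitzWith (hD 1 (by norm_num)) (hc 2 (by norm_num))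
      (hY 1 (by norm_num)) (hY 2 (by norm_num)) k2

/-- Turns evaluation of T_ζ w into an inner product with w, so that operators on U become U-valued
functions. -/
theorem opT_eq_inner {ζ : ℝ → ℝ → ℝ} {x : ℝ} {z : NoiseSpace} (hz : z =ᵐ[volume] ζ x)
    (w : NoiseSpace) : opT ζ w x = inner ℝ w z := by
  rw [L2.inner_def, opT]
  refine integral_congr_ae ?_
  filter_upwards [hz] with y hy
  simp [hy]

/-! ### Hilbert-Schmidt operators given by `L²` functions -/

section Pairing

variable {U : Type*} [NormedAddCommGroup U] [InnerProductSpace ℝ U]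

/-- The function `x ↦ ⟪w, Φ x⟫`, where `Φ ∈ L²(ℝ₊; U)`. -/
noncomputable def pairing (Φ : Lp U 2 halfLine) (w : U) : L2half := (innerSL ℝ w).compLp Φ

theorem coeFn_pairing (Φ : Lp U 2 halfLine) (w : U) :
    pairing Φ w =ᵐ[halfLine] fun x => inner ℝ w (Φ x) :=
  (innerSL ℝ w).coeFn_compLp Φ

theorem pairing_add (Φ : Lp U 2 halfLine) (v w : U) :
    pairing Φ (v + w) = pairing Φ v + pairing Φ w := by
  rw [pairing, map_add, ContinuousLinearMap.add_compLp]
  rfl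

theorem pairing_smul (Φ : Lp U 2 halfLine) (c : ℝ) (w : U) :
    pairing Φ (c • w) = c • pairing Φ w := by
  rw [pairing, map_smul, ContinuousLinearMap.smul_compLp]
  rfl

theorem pairing_sub (Φ Ψ : Lp U 2 halfLine) (w : U) :
    pairing (Φ - Ψ) w = pairing Φ w - pairing Ψ w :=
  map_sub ((innerSL ℝ w).compLpₗ 2 halfLine) Φ Ψ

theorem norm_pairing_le (Φ : Lp U 2 halfLine) (w : U) : ‖pairing Φ w‖ ≤ ‖w‖ * ‖Φ‖ := by
  have h := (innerSL ℝ w).norm_compLp_le Φ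
  rwa [innerSL_apply_norm] at h

theorem norm_sq_Lp (Φ : Lp U 2 halfLine) : ‖Φ‖ ^ 2 = ∫ x, ‖Φ x‖ ^ 2 ∂halfLine := by
  rw [← real_inner_self_eq_norm_sq, L2.inner_def]
  simp_rw [real_inner_self_eq_norm_sq]

/-- Bessel's inequality for `pairing`. -/
theorem sum_norm_pairing_sq_le {ι : Type*} {b : ι → U} (hb : Orthonormal ℝ b)
    (Φ : Lp U 2 halfLine) (s : Finset ι) : ∑ i ∈ s, ‖pairing Φ (b i)‖ ^ 2 ≤ ‖Φ‖ ^ 2 := by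
  have hi : ∀ i, Integrable (fun x => pairing Φ (b i) x ^ 2) halfLine := fun i =>
    (Lp.memLp _).integrable_sq
  have hΦ : Integrable (fun x => ‖Φ x‖ ^ 2) halfLine := (Lp.memLp Φ).norm.integrable_sq
  simp_rw [norm_sq_L2half]
  rw [← integral_finsetSum _ fun i _ => hi i, norm_sq_Lp]
  refine integral_mono_ae (integrable_finsetSum _ fun i _ => hi i) hΦ ?_
  have h : ∀ᵐ x ∂halfLine, ∀ i ∈ s, pairing Φ (b i) x = inner ℝ (b i) (Φ x) := by
    rw [Filter.eventually_all_finset]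
    exact fun i _ => coeFn_pairing Φ (b i)
  filter_upwards [h] with x hx
  refine le_trans (le_of_eq ?_) (hb.sum_inner_products_le (Φ x) (s := s))
  refine Finset.sum_congr rfl fun i hi => ?_
  rw [hx i hi, Real.norm_eq_abs, sq_abs]

end Pairing

section HSConstruction

variable {U : Type*} [NormedAddCommGroup U] [InnerProductSpace ℝ U] [CompleteSpace U]
variable {ι : Type*} [Fintype ι]

theorem sum_norm_onb_sq_le {E : Type*} [NormedAddCommGroup E] {T : U → E} {κ : ℝ} (hκ : 0 ≤ κ) {Ξ : ι → Lp U 2 halfLine}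
    (hT : ∀ w, ‖T w‖ ^ 2 ≤ κ * ∑ k, ‖pairing (Ξ k) w‖ ^ 2) (s : Finset (onbIndex U)) :
    ∑ i ∈ s, ‖T (onb U i)‖ ^ 2 ≤ κ * ∑ k, ‖Ξ k‖ ^ 2 := by
  refine (Finset.sum_le_sum fun i _ => hT (onb U i)).trans ?_
  rw [← Finset.mul_sum, Finset.sum_comm]
  exact mul_le_mul_of_nonneg_left
    (Finset.sum_le_sum fun k _ => sum_norm_pairing_sq_le (onb U).orthonormal (Ξ k) s) hκ

variable {E : Type*} [NormedAddCommGroup E] [InnerProductSpace ℝ E]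

/-- The same quantity κ ∑ ‖Ξ k‖² controls both norms: Cauchy-Schwarz under the integral bounds the
squared operator norm, Bessel the sum over the orthonormal system. -/
theorem HS.exists_toCLM_eq (T : U →ₗ[ℝ] E) {κ : ℝ} (hκ : 0 ≤ κ) (Ξ : ι → Lp U 2 halfLine)
    (hT : ∀ w, ‖T w‖ ^ 2 ≤ κ * ∑ k, ‖pairing (Ξ k) w‖ ^ 2) :
    ∃ S : HS U E, ∀ w, S.toCLM w = T w := by
  have hS : 0 ≤ κ * ∑ k, ‖Ξ k‖ ^ 2 := mul_nonneg hκ (Finset.sum_nonneg fun k _ => sq_nonneg _)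
  let T' : U →L[ℝ] E := T.mkContinuous (√(κ * ∑ k, ‖Ξ k‖ ^ 2)) fun w => by
    refine abs_le_of_sq_le_sq' ?_ (by positivity) |>.2
    rw [mul_pow, Real.sq_sqrt hS]
    refine (hT w).trans ?_
    rw [mul_assoc, Finset.sum_mul]
    refine mul_le_mul_of_nonneg_left (Finset.sum_le_sum fun k _ => ?_) hκ
    rw [← mul_pow, mul_comm]
    exact pow_le_pow_left₀ (norm_nonneg _) (norm_pairing_le _ _) 2
  have hT' : T' ∈ hsSubmodule U E := by
    refine memℓp_gen' (C := κ * ∑ k, ‖Ξ k‖ ^ 2) fun s => ?_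
    simp only [ENNReal.toReal_ofNat, Real.rpow_ofNat]
    exact sum_norm_onb_sq_le (T := T) hκ hT s
  exact ⟨⟨T', hT'⟩, fun w => rfl⟩

theorem HS.norm_sq_le_of_pairing (S : HS U E) {κ : ℝ} (hκ : 0 ≤ κ) (Ξ : ι → Lp U 2 halfLine)
    (hS : ∀ w, ‖S.toCLM w‖ ^ 2 ≤ κ * ∑ k, ‖pairing (Ξ k) w‖ ^ 2) :
    ‖S‖ ^ 2 ≤ κ * ∑ k, ‖Ξ k‖ ^ 2 := by
  have h0 : 0 ≤ κ * ∑ k, ‖Ξ k‖ ^ 2 := mul_nonneg hκ (Finset.sum_nonneg fun k _ => sq_nonneg _)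
  have h : ‖HS.toLp U E S‖ ≤ √(κ * ∑ k, ‖Ξ k‖ ^ 2) := by
    refine lp.norm_le_of_forall_sum_le (by norm_num) (Real.sqrt_nonneg _) fun s => ?_
    have h := sum_norm_onb_sq_le (T := S.toCLM) hκ hS s
    simp only [ENNReal.toReal_ofNat, Real.rpow_ofNat, Real.sq_sqrt h0]
    exact h
  calc ‖S‖ ^ 2 ≤ √(κ * ∑ k, ‖Ξ k‖ ^ 2) ^ 2 := pow_le_pow_left₀ (norm_nonneg _) h 2
    _ = _ := Real.sq_sqrt h0

end HSConstruction

/-! ### Superposition operators on `H² ∩ H¹₀` -/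

theorem IsPrim.of_hasDerivAt {F f : ℝ → ℝ} (hF : ∀ x, HasDerivAt F (f x) x) (hf : Continuous f) :
    IsPrim F f := by
  have e : _root_.deriv F = f := funext fun x => (hF x).deriv
  rw [← e]
  refine .of_contDiff (contDiff_one_iff_deriv.mpr ⟨fun x => (hF x).differentiableAt, ?_⟩)
  rwa [e]

/-- F is taken as the primitive from 0 of a representative G continuous on all of ℝ, so it is
classically C¹ and vanishes at 0; it represents f because the boundary value of f is zero. -/
theorem exists_rep_of_mem_H10 {f g h : L2half} (hf : f ∈ H10) (h1 : HasWeakDeriv f g)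
    (h2 : HasWeakDeriv g h) : ∃ F G : ℝ → ℝ, F 0 = 0 ∧ (∀ x, HasDerivAt F (G x) x) ∧
      Continuous G ∧ f =ᵐ[halfLine] F ∧ g =ᵐ[halfLine] G ∧ IsPrim G h := by
  obtain ⟨F, -, hfF, hF⟩ := h1.exists_isPrim
  obtain ⟨G, hGc, hgG, hG⟩ := h2.exists_isPrim
  have hF0 := isPrim_zero_eq_zero_of_mem_H10 hf hfF hF
  refine ⟨fun x => ∫ t in (0 : ℝ)..x, G t, G, by simp,
    fun x => (hGc.integral_hasStrictDerivAt 0 x).hasDerivAt, hGc, ?_, hgG, hG⟩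
  filter_upwards [hfF, ae_restrict_mem measurableSet_Ioi] with x hx hx0
  rw [hx, (hF.congr_deriv hgG).integral_eq (le_of_lt hx0), hF0, sub_zero]

theorem LocLip.exists_Lp {X W : Type*} [NormedAddCommGroup X] [NormedAddCommGroup W]
    {m : X → ℝ → W} (hm : LocLip 2 m) : ∃ Φ : X → Lp W 2 halfLine,
      (∀ u, Φ u =ᵐ[halfLine] m u) ∧
      ∀ R : ℝ, ∃ K : ℝ≥0, ∀ u v, ‖u‖ ≤ R → ‖v‖ ≤ R → ‖Φ u - Φ v‖ ≤ K * ‖u - v‖ := by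
  refine ⟨fun u => (hm.memLp u).toLp, fun u => (hm.memLp u).coeFn_toLp, fun R => ?_⟩
  obtain ⟨K, -, h2⟩ := hm.bound R
  refine ⟨K, fun u v hu hv => ?_⟩
  rw [← MemLp.toLp_sub, Lp.norm_toLp]
  refine ENNReal.toReal_le_of_le_ofReal (by positivity) ((h2 u v hu hv).trans (le_of_eq ?_))
  rw [ENNReal.ofReal_mul K.coe_nonneg, ofReal_norm, ENNReal.ofReal_coe_nnreal]

section Superposition

variable {X : Type*} [NormedAddCommGroup X] [NormedSpace ℝ X]
variable {U : Type*} [NormedAddCommGroup U] [InnerProductSpace ℝ U]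

/-- The `U`-valued superposition operators `u ↦ σ(x, u(x)) Y(x)` and its second derivative. -/
theorem IsSigmaCoeff.exists_superposition {σ : ℝ → ℝ → ℝ} (hσ : IsSigmaCoeff σ)
    {f g h : X →ₗ[ℝ] L2half} (hf : ∀ u, f u ∈ H10) (hfg : ∀ u, HasWeakDeriv (f u) (g u))
    (hgh : ∀ u, HasWeakDeriv (g u) (h u)) (C : ℝ≥0) (hfC : ∀ u, ‖f u‖ ≤ C * ‖u‖)
    (hhC : ∀ u, ‖h u‖ ≤ C * ‖u‖) {Y Y' Y'' : X → ℝ → U}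
    (hY : ∀ u x, HasDerivAt (Y u) (Y' u x) x) (hY' : ∀ u x, HasDerivAt (Y' u) (Y'' u x) x)
    (hYc : ∀ u, Continuous (Y'' u)) (lY : LocLip ⊤ Y) (lY' : LocLip ⊤ Y') (lY'' : LocLip ⊤ Y'') :
    ∃ Φ Θ : X → Lp U 2 halfLine,
      (∀ u, Φ u =ᵐ[halfLine] fun x => σ x (f u x) • Y u x) ∧
      (∀ R : ℝ, ∃ K : ℝ≥0, ∀ u v, ‖u‖ ≤ R → ‖v‖ ≤ R → ‖Φ u - Φ v‖ ≤ K * ‖u - v‖) ∧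
      (∀ R : ℝ, ∃ K : ℝ≥0, ∀ u v, ‖u‖ ≤ R → ‖v‖ ≤ R → ‖Θ u - Θ v‖ ≤ K * ‖u - v‖) ∧
      ∀ u w, pairing (Φ u) w ∈ H10 ∧ ∃ ψ, HasWeakDeriv (pairing (Φ u) w) ψ ∧
        HasWeakDeriv ψ (pairing (Θ u) w) := by
  -- Interpolation gives the first derivative the same constant C as f and its second derivative.
  have hgC : ∀ u, ‖g u‖ ≤ C * ‖u‖ := fun u => by
    refine (abs_le_of_sq_le_sq' ?_ (by positivity)).2
    refine (norm_weakDeriv_sq_le (hf u) (hfg u) (hgh u)).trans ?_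
    rw [sq]
    exact mul_le_mul (hfC u) (hhC u) (norm_nonneg _) (by positivity)
  have aux2 : ∀ T : X →ₗ[ℝ] L2half, (∀ u, ‖T u‖ ≤ C * ‖u‖) → LocLip 2 (fun u x => T u x) := by
    intro T hT
    refine .of_linear T C fun u => ?_
    rw [← Lp.enorm_def, enorm_eq_nnnorm, enorm_eq_nnnorm, ← ENNReal.coe_mul, ENNReal.coe_le_coe]
    exact hT u
  have auxtop : ∀ T T' : X →ₗ[ℝ] L2half, (∀ u, ‖T u‖ ≤ C * ‖u‖) → (∀ u, ‖T' u‖ ≤ C * ‖u‖) →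
      (∀ u, HasWeakDeriv (T u) (T' u)) → LocLip ⊤ (fun u x => T u x) := by
    intro T T' hT hT' hd
    -- One C for the function and one for its derivative in the Sobolev inequality.
    refine .of_linear T (C + C) fun u => ?_
    rw [eLpNorm_exponent_top, enorm_eq_nnnorm, ← ENNReal.coe_mul]
    refine eLpNormEssSup_le_of_ae_nnnorm_bound ?_
    filter_upwards [(hd u).ae_abs_le] with x hx
    rw [← NNReal.coe_le_coe]
    push_cast
    rw [add_mul]
    exact hx.trans (add_le_add (hT u) (hT' u))
  have f2 := aux2 f hfC
  have g2 := aux2 g hgC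
  have h2 := aux2 h hhC
  have ft := auxtop f g hfC hgC hfg
  have gt := auxtop g h hgC hhC hgh
  have s := hσ.coeff.locLip ft f2
  have sX := hσ.coeffX.locLip ft f2
  have sXX := hσ.coeffXX.locLip ft f2
  have sY := hσ.coeffY.locLip ft
  have sXY := hσ.coeffXY.locLip ft
  have sYY := hσ.coeffYY.locLip ft
  -- The first and second total x-derivatives of σ(x, f(x)). In the quadratic term of the second
  -- one, one factor g is placed in L^∞ and the other in L².
  have m1 := sX.add (sY.smul (r := 2) g2)
  have m2 := (sXX.add ((sXY.smul (r := 2) g2).const_smul 2)).add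
    (((sYY.smul (r := ⊤) gt).smul (r := 2) g2).add (sY.smul (r := 2) h2))
  obtain ⟨Φ, hΦ, hΦl⟩ := (s.smul (r := 2) lY).exists_Lp
  -- Ψ only represents the intermediate weak derivative; its Lipschitz bound is never needed, as the
  -- graph norm does not see first derivatives.
  obtain ⟨Ψ, hΨ, -⟩ := ((m1.smul (r := 2) lY).add (s.smul (r := 2) lY')).exists_Lp
  obtain ⟨Θ, hΘ, hΘl⟩ := ((m2.smul (r := 2) lY).add
    (((m1.smul (r := 2) lY').const_smul 2).add (s.smul (r := 2) lY''))).exists_Lp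
  refine ⟨Φ, Θ, hΦ, hΦl, hΘl, fun u w => ?_⟩
  obtain ⟨F, G, hF0, hF, hGc, hfF, hgG, hG⟩ := exists_rep_of_mem_H10 (hf u) (hfg u) (hgh u)
  have hFc : Continuous F := continuous_iff_continuousAt.mpr fun x => (hF x).continuousAt
  have hc2 := hσ.contDiff
  have hX2 := contDiff_partialX (n := 1) (by exact_mod_cast hc2)
  have hY2 := contDiff_partialY (n := 1) (by exact_mod_cast hc2)
  have hprim : ∀ τ : ℝ → ℝ → ℝ, ContDiff ℝ 1 (fun p : ℝ × ℝ => τ p.1 p.2) →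
      IsPrim (fun x => τ x (F x)) (fun x => partialX τ x (F x) + partialY τ x (F x) * G x) := by
    intro τ hτ
    have hx := contDiff_partialX (n := 0) (by exact_mod_cast hτ)
    have hy := contDiff_partialY (n := 0) (by exact_mod_cast hτ)
    have hcF : Continuous fun x => ((x, F x) : ℝ × ℝ) := by fun_prop
    exact .of_hasDerivAt (fun x => hasDerivAt_comp_graph (hτ.differentiable (by simp)) (hF x))
      ((hx.continuous.comp hcF).add ((hy.continuous.comp hcF).mul hGc))
  have hyd : ∀ x, HasDerivAt (fun x => inner ℝ w (Y u x)) (inner ℝ w (Y' u x)) x := fun x =>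
    (innerSL ℝ w).hasFDerivAt.comp_hasDerivAt x (hY u x)
  have hyd' : ∀ x, HasDerivAt (fun x => inner ℝ w (Y' u x)) (inner ℝ w (Y'' u x)) x := fun x =>
    (innerSL ℝ w).hasFDerivAt.comp_hasDerivAt x (hY' u x)
  have hy : IsPrim (fun x => inner ℝ w (Y u x)) (fun x => inner ℝ w (Y' u x)) :=
    .of_hasDerivAt hyd (continuous_iff_continuousAt.mpr fun x => (hyd' x).continuousAt)
  have hy' : IsPrim (fun x => inner ℝ w (Y' u x)) (fun x => inner ℝ w (Y'' u x)) :=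
    .of_hasDerivAt hyd' (continuous_const.inner (hYc u))
  have p0 := hprim σ (hc2.of_le (by norm_num))
  have pX := hprim (partialX σ) (by exact_mod_cast hX2)
  have pY := hprim (partialY σ) (by exact_mod_cast hY2)
  rw [partialY_partialX hc2] at pX
  have q0 := p0.mul hy
  have q1 := ((pX.add (pY.mul hG)).mul hy).add (p0.mul hy')
  have e0 : pairing (Φ u) w =ᵐ[halfLine] fun x => σ x (F x) * inner ℝ w (Y u x) := by
    filter_upwards [coeFn_pairing (Φ u) w, hΦ u, hfF] with x h1 h2 h3
    rw [h1, h2, h3, real_inner_smul_right]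
  have e1 : pairing (Ψ u) w =ᵐ[halfLine] fun x =>
      (partialX σ x (F x) + partialY σ x (F x) * G x) * inner ℝ w (Y u x) +
        σ x (F x) * inner ℝ w (Y' u x) := by
    filter_upwards [coeFn_pairing (Ψ u) w, hΨ u, hfF, hgG] with x h1 h2 h3 h4
    rw [h1, h2, h3, h4]
    simp only [inner_add_right, real_inner_smul_right, smul_eq_mul]
  have r0 := q0.congr_deriv e1.symm
  -- The representative vanishes at 0 since F(0) = 0 and σ(0,0) = 0.
  refine ⟨mem_H10_of_isPrim e0 r0 (by simp [hF0, hσ.boundary]), pairing (Ψ u) w,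
    .of_isPrim e0 r0, .of_isPrim e1 (q1.congr_deriv ?_)⟩
  filter_upwards [coeFn_pairing (Θ u) w, hΘ u, hfF, hgG] with x h1 h2 h3 h4
  rw [h1, h2, h3, h4]
  simp only [inner_add_right, real_inner_smul_right, smul_eq_mul]
  ring

end Superposition

/-- The L^∞ norm in x is indifferent to translation, and shifting by q(u) instead of q(v) changes Z
by at most M |q(u) - q(v)|, uniformly in x. -/
theorem IsBddLip.locLip {X : Type*} [NormedAddCommGroup X] {M : ℝ≥0} {Z : ℝ → NoiseSpace}
    (hZ : IsBddLip M Z) {q : X → ℝ} (hq : ∀ u v, |q u - q v| ≤ ‖u - v‖) (ε : ℝ) :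
    LocLip ⊤ (fun u x => Z (q u + ε * x)) where
  meas u := (hZ.lip.continuous.comp (by fun_prop)).aestronglyMeasurable
  bound R := by
    refine ⟨M, fun u _ => ?_, fun u v _ _ => ?_⟩
    · rw [eLpNorm_exponent_top]
      exact eLpNormEssSup_le_of_ae_nnnorm_bound (.of_forall fun x => hZ.bdd _)
    · rw [eLpNorm_exponent_top, enorm_eq_nnnorm, ← ENNReal.coe_mul]
      refine eLpNormEssSup_le_of_ae_nnnorm_bound (.of_forall fun x => ?_)
      rw [← NNReal.coe_le_coe, Pi.sub_apply, coe_nnnorm, ← dist_eq_norm]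
      refine (hZ.lip.dist_le_mul _ _).trans ?_
      rw [Real.dist_eq, add_sub_add_right_eq_sub, NNReal.coe_mul]
      exact mul_le_mul_of_nonneg_left (hq u v) M.2

/-! ### Components of D(𝒜) and the graph norm. -/

/-- The first weak derivative `H²(ℝ₊) → L²(ℝ₊)`. -/
noncomputable def weakDeriv1 : H2 →ₗ[ℝ] L2half where
  toFun f := f.2.choose
  map_add' f f' := (f + f').2.choose_spec.choose_spec.1.unique
    (f.2.choose_spec.choose_spec.1.add f'.2.choose_spec.choose_spec.1)
  map_smul' c f := (c • f).2.choose_spec.choose_spec.1.unique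
    (f.2.choose_spec.choose_spec.1.smul c)

theorem hasWeakDeriv_weakDeriv1 (f : H2) : HasWeakDeriv f (weakDeriv1 f) :=
  f.2.choose_spec.choose_spec.1

theorem hasWeakDeriv_weakDeriv2 (f : H2) : HasWeakDeriv (weakDeriv1 f) (weakDeriv2 f) :=
  f.2.choose_spec.choose_spec.2

section Domain

variable (ηp ηm c : ℝ)

/-- The component `u₁` of `u ∈ D(𝒜)`, as an element of `H²(ℝ₊)`. -/
noncomputable def dom1 : GraphDomain (opA ηp ηm c) →ₗ[ℝ] H2 :=
  (pr1 ∘ₗ GraphDomain.incl (opA ηp ηm c)).codRestrict H2 fun u =>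
    (Subtype.prop (p := fun x => x ∈ (opA ηp ηm c).domain) u).1.1

/-- The component `u₂` of `u ∈ D(𝒜)`, as an element of `H²(ℝ₊)`. -/
noncomputable def dom2 : GraphDomain (opA ηp ηm c) →ₗ[ℝ] H2 :=
  (pr2 ∘ₗ GraphDomain.incl (opA ηp ηm c)).codRestrict H2 fun u =>
    (Subtype.prop (p := fun x => x ∈ (opA ηp ηm c).domain) u).2.1

variable {ηp ηm c}

theorem dom1_mem_H10 (u : GraphDomain (opA ηp ηm c)) : (dom1 ηp ηm c u : L2half) ∈ H10 :=
  (Subtype.prop (p := fun x => x ∈ (opA ηp ηm c).domain) u).1.2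

theorem dom2_mem_H10 (u : GraphDomain (opA ηp ηm c)) : (dom2 ηp ηm c u : L2half) ∈ H10 :=
  (Subtype.prop (p := fun x => x ∈ (opA ηp ηm c).domain) u).2.2

theorem norm_sq_L2sum (v : L2sum) : ‖v‖ ^ 2 = ‖pr1 v‖ ^ 2 + (‖pr2 v‖ ^ 2 + ‖pr3 v‖ ^ 2) := by
  rw [WithLp.prod_norm_sq_eq_of_L2, WithLp.prod_norm_sq_eq_of_L2 v.snd]
  rfl

theorem pr1_op (u : GraphDomain (opA ηp ηm c)) : pr1 (GraphDomain.op _ u) =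
    ηp • weakDeriv2 (dom1 ηp ηm c u) - c • (dom1 ηp ηm c u : L2half) := rfl

theorem pr2_op (u : GraphDomain (opA ηp ηm c)) : pr2 (GraphDomain.op _ u) =
    ηm • weakDeriv2 (dom2 ηp ηm c u) - c • (dom2 ηp ηm c u : L2half) := rfl

theorem pr3_op (u : GraphDomain (opA ηp ηm c)) : pr3 (GraphDomain.op _ u) =
    0 - c • pr3 (GraphDomain.incl _ u) := rfl

theorem norm_pr1_le (v : L2sum) : ‖pr1 v‖ ≤ ‖v‖ :=
  (abs_le_of_sq_le_sq' (by rw [norm_sq_L2sum v]; nlinarith [sq_nonneg ‖pr2 v‖, sq_nonneg ‖pr3 v‖])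
    (norm_nonneg v)).2

theorem norm_pr2_le (v : L2sum) : ‖pr2 v‖ ≤ ‖v‖ :=
  (abs_le_of_sq_le_sq' (by rw [norm_sq_L2sum v]; nlinarith [sq_nonneg ‖pr1 v‖, sq_nonneg ‖pr3 v‖])
    (norm_nonneg v)).2

theorem norm_pr3_le (v : L2sum) : ‖pr3 v‖ ≤ ‖v‖ :=
  (abs_le_of_sq_le_sq' (by rw [norm_sq_L2sum v]; nlinarith [sq_nonneg ‖pr1 v‖, sq_nonneg ‖pr2 v‖])
    (norm_nonneg v)).2

theorem GraphDomain.norm_incl_le (u : GraphDomain (opA ηp ηm c)) :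
    ‖GraphDomain.incl _ u‖ ≤ ‖u‖ :=
  (abs_le_of_sq_le_sq' (by rw [GraphDomain.norm_sq]; linarith [sq_nonneg ‖GraphDomain.op _ u‖])
    (norm_nonneg u)).2

theorem GraphDomain.norm_op_le (u : GraphDomain (opA ηp ηm c)) : ‖GraphDomain.op _ u‖ ≤ ‖u‖ :=
  (abs_le_of_sq_le_sq' (by rw [GraphDomain.norm_sq]; linarith [sq_nonneg ‖GraphDomain.incl _ u‖])
    (norm_nonneg u)).2

/-- Recovers the second derivative from the graph norm: adding back c f isolates η d, and η > 0
allows division. -/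
theorem norm_le_of_smul_sub_le {η N : ℝ} (hη : 0 < η) (hc : 0 < c) {d f : L2half}
    (h : ‖η • d - c • f‖ ≤ N) (hf : ‖f‖ ≤ N) : ‖d‖ ≤ (1 + c) / η * N := by
  have h1 : ‖η • d‖ ≤ N + c * N := by
    have e : η • d = (η • d - c • f) + c • f := by abel
    rw [e]
    refine (norm_add_le _ _).trans (add_le_add h ?_)
    rw [norm_smul, Real.norm_eq_abs, abs_of_pos hc]
    exact mul_le_mul_of_nonneg_left hf hc.le
  rw [norm_smul, Real.norm_eq_abs, abs_of_pos hη] at h1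
  rw [div_mul_eq_mul_div, le_div_iff₀ hη]
  linarith

theorem norm_smul_sub_smul_sq_le (a b : ℝ) (d f : L2half) :
    ‖a • d - b • f‖ ^ 2 ≤ 2 * a ^ 2 * ‖d‖ ^ 2 + 2 * b ^ 2 * ‖f‖ ^ 2 := by
  have h := norm_sub_le (a • d) (b • f)
  rw [norm_smul, norm_smul, Real.norm_eq_abs, Real.norm_eq_abs] at h
  have h2 := pow_le_pow_left₀ (norm_nonneg _) h 2
  have h3 := add_sq_le (a := |a| * ‖d‖) (b := |b| * ‖f‖)
  rw [mul_pow, mul_pow, sq_abs, sq_abs] at h3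
  linarith

/-- The graph norm is controlled by the components and their second derivatives. -/
theorem exists_norm_sq_le (ηp ηm c : ℝ) : ∃ κ : ℝ, 0 ≤ κ ∧
    ∀ u : GraphDomain (opA ηp ηm c), pr3 (GraphDomain.incl _ u) = 0 →
      ‖u‖ ^ 2 ≤ κ * (‖(dom1 ηp ηm c u : L2half)‖ ^ 2 + ‖weakDeriv2 (dom1 ηp ηm c u)‖ ^ 2 +
        ‖(dom2 ηp ηm c u : L2half)‖ ^ 2 + ‖weakDeriv2 (dom2 ηp ηm c u)‖ ^ 2) := by
  -- The components need the coefficient 1 + 2c², their second derivatives 2η₊² and 2η₋²; the sum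
  -- serves for all four terms.
  refine ⟨1 + 2 * c ^ 2 + 2 * ηp ^ 2 + 2 * ηm ^ 2, by positivity, fun u hu => ?_⟩
  rw [GraphDomain.norm_sq, norm_sq_L2sum, norm_sq_L2sum, pr1_op, pr2_op, pr3_op, hu, smul_zero,
    sub_zero, norm_zero]
  have h1 := norm_smul_sub_smul_sq_le ηp c (weakDeriv2 (dom1 ηp ηm c u)) (dom1 ηp ηm c u)
  have h2 := norm_smul_sub_smul_sq_le ηm c (weakDeriv2 (dom2 ηp ηm c u)) (dom2 ηp ηm c u)
  have e1 : ‖pr1 (GraphDomain.incl _ u)‖ = ‖(dom1 ηp ηm c u : L2half)‖ := rfl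
  have e2 : ‖pr2 (GraphDomain.incl _ u)‖ = ‖(dom2 ηp ηm c u : L2half)‖ := rfl
  rw [e1, e2]
  set a := ‖(dom1 ηp ηm c u : L2half)‖
  set b := ‖(dom2 ηp ηm c u : L2half)‖
  set A := ‖weakDeriv2 (dom1 ηp ηm c u)‖
  set B := ‖weakDeriv2 (dom2 ηp ηm c u)‖
  have h3 : 0 ≤ (2 * ηp ^ 2 + 2 * ηm ^ 2) * (a ^ 2 + b ^ 2) +
      (1 + 2 * c ^ 2 + 2 * ηm ^ 2) * A ^ 2 + (1 + 2 * c ^ 2 + 2 * ηp ^ 2) * B ^ 2 := by positivity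
  linarith

/-- The element of `D(𝒜)` with given components in `H² ∩ H¹₀`. -/
noncomputable def mkDom (ηp ηm c : ℝ) (f₁ f₂ : L2half) (h₁ : f₁ ∈ H2 ⊓ H10) (h₂ : f₂ ∈ H2 ⊓ H10) :
    GraphDomain (opA ηp ηm c) :=
  (⟨WithLp.toLp 2 (f₁, WithLp.toLp 2 (f₂, 0)), ⟨h₁, h₂⟩⟩ : (opA ηp ηm c).domain)

theorem GraphDomain.ext_components {u v : GraphDomain (opA ηp ηm c)}
    (h1 : pr1 (GraphDomain.incl _ u) = pr1 (GraphDomain.incl _ v))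
    (h2 : pr2 (GraphDomain.incl _ u) = pr2 (GraphDomain.incl _ v))
    (h3 : pr3 (GraphDomain.incl _ u) = pr3 (GraphDomain.incl _ v)) : u = v := by
  refine Subtype.ext ?_
  have h : GraphDomain.incl _ u - GraphDomain.incl _ v = 0 := by
    rw [← norm_eq_zero, ← sq_eq_zero_iff, norm_sq_L2sum, map_sub, map_sub, map_sub, h1, h2, h3]
    simp
  exact sub_eq_zero.mp h

end Domain

/-! ### Assembly of the noise coefficient. -/

theorem mainTheorem11 (ηp ηm c : ℝ) (hηp : 0 < ηp) (hηm : 0 < ηm) (hc : 0 < c)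
    (σp σm ζ : ℝ → ℝ → ℝ) (hσp : SigmaAssumption σp) (hσm : SigmaAssumption σm)
    (hζ : ZetaAssumption ζ) :
    ∃ C : GraphDomain (opA ηp ηm c) → HS NoiseSpace (GraphDomain (opA ηp ηm c)),
      (∀ u w, IsNoiseCoeff σp σm ζ (GraphDomain.incl _ u) w
        (GraphDomain.incl _ ((C u).toCLM w))) ∧
      ∀ B : Set (GraphDomain (opA ηp ηm c)), Bornology.IsBounded B →
        ∃ L : ℝ≥0, LipschitzOnWith L C B := by
  obtain ⟨Z, Z', Z'', M, hZζ, hZ, hZ', bZ, bZ', bZ''⟩ := hζ.exists_curve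
  let X := GraphDomain (opA ηp ηm c)
  let q : X → ℝ := fun u => pr3 (GraphDomain.incl _ u)
  have hq : ∀ u v : X, |q u - q v| ≤ ‖u - v‖ := fun u v => by
    have h := (norm_pr3_le _).trans (GraphDomain.norm_incl_le (u - v))
    rwa [map_sub, map_sub, Real.norm_eq_abs] at h
  have hd : ∀ (ε : ℝ) (W W' : ℝ → NoiseSpace), (∀ x, HasDerivAt W (W' x) x) → ∀ (u : X) (x : ℝ),
      HasDerivAt (fun x => W (q u + ε * x)) (ε • W' (q u + ε * x)) x := by
    intro ε W W' hW u x
    have h1 : HasDerivAt (fun x : ℝ => q u + ε * x) ε x := by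
      simpa using ((hasDerivAt_id x).const_mul ε).const_add (q u)
    exact (hW _).scomp x h1
  have hcZ : ∀ (ε : ℝ) (u : X), Continuous fun x => ε • ε • Z'' (q u + ε * x) := fun ε u =>
    ((bZ''.lip.continuous.comp (by fun_prop : Continuous fun x : ℝ => q u + ε * x)).const_smul
      ε).const_smul ε
  have bound1 : ∀ u : X, ‖weakDeriv2 (dom1 ηp ηm c u)‖ ≤ (1 + c) / ηp * ‖u‖ := fun u =>
    norm_le_of_smul_sub_le hηp hc (pr1_op u ▸ (norm_pr1_le _).trans (GraphDomain.norm_op_le u))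
      ((norm_pr1_le _).trans (GraphDomain.norm_incl_le u))
  have bound2 : ∀ u : X, ‖weakDeriv2 (dom2 ηp ηm c u)‖ ≤ (1 + c) / ηm * ‖u‖ := fun u =>
    norm_le_of_smul_sub_le hηm hc (pr2_op u ▸ (norm_pr2_le _).trans (GraphDomain.norm_op_le u))
      ((norm_pr2_le _).trans (GraphDomain.norm_incl_le u))
  -- One constant for both components: 1 covers the inclusion into 𝓛², the other summands the second
  -- derivatives.
  let K : ℝ≥0 := (1 + (1 + c) / ηp + (1 + c) / ηm).toNNReal
  have hK : (K : ℝ) = 1 + (1 + c) / ηp + (1 + c) / ηm := Real.coe_toNNReal _ (by positivity)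
  have hp0 : 0 < (1 + c) / ηp := by positivity
  have hm0 : 0 < (1 + c) / ηm := by positivity
  -- The curve x ↦ Z(u₃ + εx) picks up a factor ε with each derivative; ε = 1 and ε = -1 give the
  -- two components.
  have superposition : ∀ (ε : ℝ) (σ : ℝ → ℝ → ℝ) (_ : IsSigmaCoeff σ) (d : X →ₗ[ℝ] H2)
      (_ : ∀ u, (d u : L2half) ∈ H10) (_ : ∀ u, ‖(d u : L2half)‖ ≤ K * ‖u‖)
      (_ : ∀ u, ‖weakDeriv2 (d u)‖ ≤ K * ‖u‖), _ :=
    fun ε σ hσ d hd0 hd1 hd2 => hσ.exists_superposition (f := H2.subtype ∘ₗ d)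
      (g := weakDeriv1 ∘ₗ d) (h := weakDeriv2 ∘ₗ d) hd0 (fun u => hasWeakDeriv_weakDeriv1 _)
      (fun u => hasWeakDeriv_weakDeriv2 _) K hd1 hd2 (hd ε Z Z' hZ)
      (fun u x => (hd ε Z' Z'' hZ' u x).const_smul ε) (hcZ ε)
      (bZ.locLip hq ε) ((bZ'.locLip hq ε).const_smul ε)
      (((bZ''.locLip hq ε).const_smul ε).const_smul ε)
  obtain ⟨Φ₁, Θ₁, hΦ₁, lΦ₁, lΘ₁, hw₁⟩ := superposition 1 σp hσp.isSigmaCoeff (dom1 ηp ηm c)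
    dom1_mem_H10
    (fun u => ((norm_pr1_le _).trans (GraphDomain.norm_incl_le u)).trans
      (le_mul_of_one_le_left (norm_nonneg _) (by rw [hK]; linarith)))
    (fun u => (bound1 u).trans (mul_le_mul_of_nonneg_right (by rw [hK]; linarith) (norm_nonneg _)))
  obtain ⟨Φ₂, Θ₂, hΦ₂, lΦ₂, lΘ₂, hw₂⟩ := superposition (-1) _ hσm.isSigmaCoeff.reflect
    (dom2 ηp ηm c) dom2_mem_H10
    (fun u => ((norm_pr2_le _).trans (GraphDomain.norm_incl_le u)).trans
      (le_mul_of_one_le_left (norm_nonneg _) (by rw [hK]; linarith)))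
    (fun u => (bound2 u).trans (mul_le_mul_of_nonneg_right (by rw [hK]; linarith) (norm_nonneg _)))
  obtain ⟨κ, hκ, hκn⟩ := exists_norm_sq_le ηp ηm c
  have mem₁ : ∀ u w, pairing (Φ₁ u) w ∈ H2 ⊓ H10 := fun u w =>
    ⟨⟨_, _, (hw₁ u w).2.choose_spec⟩, (hw₁ u w).1⟩
  have mem₂ : ∀ u w, pairing (Φ₂ u) w ∈ H2 ⊓ H10 := fun u w =>
    ⟨⟨_, _, (hw₂ u w).2.choose_spec⟩, (hw₂ u w).1⟩
  let T : X → NoiseSpace →ₗ[ℝ] X := fun u =>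
    { toFun := fun w => mkDom ηp ηm c _ _ (mem₁ u w) (mem₂ u w)
      map_add' := fun v w => GraphDomain.ext_components (pairing_add _ v w) (pairing_add _ v w)
        (add_zero (0 : ℝ)).symm
      map_smul' := fun r w => GraphDomain.ext_components (pairing_smul _ r w) (pairing_smul _ r w)
        (smul_zero r).symm }
  have d₁ : ∀ u w, weakDeriv2 (dom1 ηp ηm c (T u w)) = pairing (Θ₁ u) w := fun u w =>
    weakDeriv2_eq _ (hw₁ u w).2.choose_spec.1 (hw₁ u w).2.choose_spec.2
  have d₂ : ∀ u w, weakDeriv2 (dom2 ηp ηm c (T u w)) = pairing (Θ₂ u) w := fun u w =>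
    weakDeriv2_eq _ (hw₂ u w).2.choose_spec.1 (hw₂ u w).2.choose_spec.2
  -- Four U-valued functions carry the whole graph norm of C(u)w: the two components and their
  -- second derivatives.
  let Ξ : X → Fin 4 → Lp NoiseSpace 2 halfLine := fun u => ![Φ₁ u, Θ₁ u, Φ₂ u, Θ₂ u]
  have hT : ∀ u w, ‖T u w‖ ^ 2 ≤ κ * ∑ k, ‖pairing (Ξ u k) w‖ ^ 2 := fun u w => by
    have h := hκn (T u w) rfl
    rw [d₁, d₂] at h
    rw [Fin.sum_univ_four]
    exact h
  choose C hC using fun u => HS.exists_toCLM_eq (T u) hκ (Ξ u) (hT u)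
  have hdiff : ∀ u v, ‖C u - C v‖ ^ 2 ≤ κ * ∑ k, ‖(Ξ u - Ξ v) k‖ ^ 2 := by
    intro u v
    refine (C u - C v).norm_sq_le_of_pairing hκ _ fun w => ?_
    have e : (C u - C v).toCLM w = T u w - T v w := by
      rw [← hC, ← hC]
      rfl
    -- Since `pairing` is linear in the U-valued function, the estimate that puts C(u) in HS also
    -- applies to differences, with Ξ(u) - Ξ(v).
    have h := hκn (T u w - T v w) (by rw [map_sub, map_sub]; exact sub_self (0 : ℝ))
    rw [map_sub, map_sub, map_sub, map_sub, d₁, d₁, d₂, d₂] at h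
    rw [e, Fin.sum_univ_four]
    simp only [Pi.sub_apply, pairing_sub]
    exact h
  refine ⟨C, fun u w => ⟨?_, ?_, ?_⟩, fun B hB => ?_⟩
  · rw [hC]
    filter_upwards [coeFn_pairing (Φ₁ u) w, hΦ₁ u] with x h1 h2
    rw [opT_eq_inner (hZζ _)]
    refine h1.trans ?_
    rw [h2, real_inner_smul_right, one_mul]
    rfl
  · rw [hC]
    filter_upwards [coeFn_pairing (Φ₂ u) w, hΦ₂ u] with x h1 h2
    rw [opT_eq_inner (hZζ _)]
    refine h1.trans ?_
    rw [h2, real_inner_smul_right, neg_one_mul, ← sub_eq_add_neg]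
    rfl
  · rw [hC]
    rfl
  · obtain ⟨R, hR⟩ := hB.exists_norm_le
    obtain ⟨K1, hK1⟩ := lΦ₁ R
    obtain ⟨K2, hK2⟩ := lΘ₁ R
    obtain ⟨K3, hK3⟩ := lΦ₂ R
    obtain ⟨K4, hK4⟩ := lΘ₂ R
    refine ⟨(√(κ * ((K1 : ℝ) ^ 2 + (K2 : ℝ) ^ 2 + (K3 : ℝ) ^ 2 + (K4 : ℝ) ^ 2))).toNNReal,
      LipschitzOnWith.of_dist_le_mul fun u hu v hv => ?_⟩
    rw [Real.coe_toNNReal _ (Real.sqrt_nonneg _), dist_eq_norm, dist_eq_norm]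
    refine (abs_le_of_sq_le_sq' ?_ (by positivity)).2
    rw [mul_pow, Real.sq_sqrt (by positivity)]
    refine (hdiff u v).trans ?_
    rw [mul_assoc]
    refine mul_le_mul_of_nonneg_left ?_ hκ
    rw [Fin.sum_univ_four]
    have s1 := pow_le_pow_left₀ (norm_nonneg _) (hK1 u v (hR u hu) (hR v hv)) 2
    have s2 := pow_le_pow_left₀ (norm_nonneg _) (hK2 u v (hR u hu) (hR v hv)) 2
    have s3 := pow_le_pow_left₀ (norm_nonneg _) (hK3 u v (hR u hu) (hR v hv)) 2
    have s4 := pow_le_pow_left₀ (norm_nonneg _) (hK4 u v (hR u hu) (hR v hv)) 2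
    rw [mul_pow] at s1 s2 s3 s4
    refine le_trans (add_le_add (add_le_add (add_le_add s1 s2) s3) s4) (le_of_eq ?_)
    ring
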